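/- Let $K\subset\mathbb R^n$ be a compact convex set with $0\in\operatorname{int}K$. Let $\gamma(x)=\inf\{\lambda>0: x/\lambda\in K\}$ be its gauge, $K^\circ=\{x:\langle x,y\rangle\le 1 \text{ for all } y\in K\}$ its polar, and $\gamma^\circ$ the gauge of $K^\circ$. For $p\in\partial K$ let $N(K,p)=\{v:\langle z-p,v\rangle\le 0\text{ for all }z\in K\}$ be the normal cone of $K$ at $p$. Let $U\subset\mathbb R^n$ be a bounded open set whose boundary is of class $C^{k,\alpha}$, where $k\ge 1$ is an integer and $0\le\alpha\le 1$ (locally, $U$ is the region above the graph of a $C^{k,\alpha}$ function in some direction), and let $\nu$ be the inward unit normal to $\partial U$. Put $\rho(x)=\min_{y\in\partial U}\gamma(x-y)$, and call $y\in\partial U$ a $\rho$-closest point to $x$ if $\rho(x)=\gamma(x-y)$. Let $d(x)=\min_{z\in\partial U}|x-z|$ be the Euclidean distance to $\partial U$. Where $\gamma^\circ$ is differentiable at $v\neq0$, put $$X(v)=\frac{1}{\gamma^\circ(v)}\,D\gamma^\circ(v)\otimes v,\qquad (a\otimes b)z=\langle z,b\rangle a .$$ Let $x_0\in U$, suppose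 that $y_0\in\partial U$ is the unique $\rho$-closest point to $x_0$, and suppose that $\nu(y_0)$ is an interior point of $N\big(K,\tfrac{x_0-y_0}{\rho(x_0)}\big)$. Then there is an open ball $B\subset U$ centred at $x_0$ such that: 1. $\rho$ is $C^{k,\alpha}$ on $B$. 2. Every $x\in B$ has a unique $\rho$-closest point $y(x)\in\partial U$; the map $x\mapsto y(x)$ is $C^{k,\alpha}$ on $B$, and $y(x)\to y_0$ as $x\to x_0$. 3. For every $x\in B$, writing $y=y(x)$ and $\nu=\nu(y)$, the function $\gamma^\circ$ is differentiable at $\nu$, and $$D\rho(x)=\frac{\nu}{\gamma^\circ(\nu)},\qquad Dy(x)=I-X(\nu).$$ 4. If $k\ge2$, then moreover, for every such $x$, the function $d|_{\overline U}$ is $C^2$ near $y$ up to the boundary, and $$D^2\rho(x)=\frac{1}{\gamma^\circ(\nu)}\,(I-X^T)\,D^2d(y)\,(I-X),\qquad X=X(\nu),$$ where $D^2d(y)$ is the second derivative at $y\in\partial U$ of the restriction of $d$ to $\overline U$. -/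

import Mathlib

open Set Filter Topology
open scoped NNReal Gradient RealInnerProductSpace

namespace GaugeDist

variable {E : Type*} [NormedAddCommGroup E] [InnerProductSpace ℝ E]

/-! ### Convex geometry. The gauge function of `K` is Mathlib's `gauge K`. -/

/-- The polar `K°` of `K`. -/
def polarSet (K : Set E) : Set E :=
  {x | ∀ y ∈ K, ⟪x, y⟫ ≤ 1}

/-- The gauge function `γ°` of the polar `K°`. -/
noncomputable def polarGauge (K : Set E) : E → ℝ :=
  gauge (polarSet K)

/-- The normal cone `N(K, x)`: zero together with all outer normal vectors of `K` at `x`. -/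
def normalCone (K : Set E) (x : E) : Set E :=
  {v | ∀ z ∈ K, ⟪z - x, v⟫ ≤ 0}

/-- `X(v) = (1 / γ°(v)) Dγ°(v) ⊗ v`, that is `z ↦ (⟪v, z⟫ / γ°(v)) Dγ°(v)`. -/
noncomputable def obliqueProj [CompleteSpace E] (K : Set E) (v : E) : E →L[ℝ] E :=
  (polarGauge K v)⁻¹ • InnerProductSpace.rankOne ℝ (∇ (polarGauge K) v) v

/-! ### Distance to the boundary -/

/-- The distance `ρ(x) = min_{y ∈ ∂U} γ(x - y)` to `∂U` with respect to the gauge of `K`. -/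
noncomputable def rho (K U : Set E) (x : E) : ℝ :=
  sInf ((fun y => gauge K (x - y)) '' frontier U)

/-- `y` is a `ρ`-closest point to `x` on `∂U`. -/
def IsRhoClosest (K U : Set E) (x y : E) : Prop :=
  y ∈ frontier U ∧ rho K U x = gauge K (x - y)

/-- `y` is the unique `ρ`-closest point to `x` on `∂U`. -/
def IsUniqueRhoClosest (K U : Set E) (x y : E) : Prop :=
  IsRhoClosest K U x y ∧ ∀ z, IsRhoClosest K U x z → z = y

/-- The Euclidean distance `d` to `∂U`. -/
noncomputable def bdryDist (U : Set E) (x : E) : ℝ :=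
  Metric.infDist x (frontier U)

/-- The second derivative of `f` relative to `s`, as a linear map. With `s = closure U` and
`y ∈ ∂U` it is the second derivative at `y` of a function that is `C²` up to the boundary of `U`. -/
noncomputable def hessianWithin [CompleteSpace E] (f : E → ℝ) (s : Set E) (y : E) : E →L[ℝ] E :=
  fderivWithin ℝ (fun z => gradientWithin f s z) s y

/-! ### Regularity -/

/-- `f` is of class `C^{k,α}` on the open set `s`: it is `C^k` there and its `k`-th derivative is
`α`-Hölder continuous on `s`. For `α = 0` the second part says that the oscillation of the `k`-th
derivative on `s` is finite. -/
def IsCkHolderOn {V W : Type*} [NormedAddCommGroup V] [NormedSpace ℝ V]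
    [NormedAddCommGroup W] [NormedSpace ℝ W] (k : ℕ) (α : ℝ≥0) (f : V → W) (s : Set V) : Prop :=
  ContDiffOn ℝ k f s ∧ ∃ C : ℝ≥0, HolderOnWith C α (iteratedFDeriv ℝ k f) s

/-- `∂U` is of class `C^{k,α}`: near each boundary point, `U` is the region above the graph, in some
direction `e`, of a `C^{k,α}` function of the variables orthogonal to `e`. -/
def HasCkHolderBoundary (k : ℕ) (α : ℝ≥0) (U : Set E) : Prop :=
  ∀ p ∈ frontier U, ∃ e : E, ‖e‖ = 1 ∧ ∃ g : (ℝ ∙ e)ᗮ → ℝ, ∃ r : ℝ, 0 < r ∧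
    IsCkHolderOn k α g (Metric.ball ((ℝ ∙ e)ᗮ.orthogonalProjectionOnto p) r) ∧
    ∀ x ∈ Metric.ball p r, x ∈ U ↔ g ((ℝ ∙ e)ᗮ.orthogonalProjectionOnto x) < ⟪e, x⟫

/-- `v` is the inward unit normal to `∂U` at `y`: a unit vector, orthogonal to every vector tangent
to `∂U` at `y`, that points into `U`. -/
def IsInwardUnitNormal (U : Set E) (y v : E) : Prop :=
  ‖v‖ = 1 ∧ (∀ w ∈ tangentConeAt ℝ (frontier U) y, ⟪v, w⟫ = 0) ∧
    ∀ᶠ t : ℝ in 𝓝[>] 0, y + t • v ∈ U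

open Classical in
/-- The inward unit normal `ν` to `∂U` (it exists and is unique when `∂U` is `C¹`; the value is `0`
where there is no such vector). -/
noncomputable def inwardNormal (U : Set E) (y : E) : E :=
  if h : ∃ v, IsInwardUnitNormal U y v then h.choose else 0

end GaugeDist

/-!
The hypothesis says that `p = (x₀ - y₀) / ρ(x₀)` is a corner of `K`: the inward normal `ν(y₀)` lies
in the interior of the normal cone `N(K, p)`. If `y` is closest to `x ∈ U`, then `x - ρ(x) K` touches
`∂U` from inside at `y`, so `ν(y)` lies in the normal cone of `K` at `(x - y) / ρ(x)`
(`IsGraphDefining.gradient_mem_normalCone`). For `x` near `x₀` the point `y` is near `y₀` by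
compactness, so `ν(y)` still lies in the interior of `N(K, p)`, and a vector there is normal to `K`
at no point other than `p`. Hence `(x - y) / ρ(x) = p`: all points near `x₀` are joined to
their closest points in the same direction, and `y(x) = x - ρ(x) p`
(`IsGraphDefining.eventually_isUniqueRhoClosest`).

Near `y₀` write `U = {F > 0}`, with `F` of class `C^{k,α}` and `∇F ≠ 0`. The equation
`F (x - ρ(x) p) = 0`, together with the Lipschitz continuity of `ρ`, gives
`Dρ(x) = DF(y) / DF(y)(p)`, that is `∇ρ = ν / ⟪p, ν⟫`, and this formula raises the regularity of `ρ`
one derivative at a time up to `C^{k,α}` (`ckHolderAt_of_implicit`). On `N(K, p)` the polar gauge is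
the linear function `⟪p, ·⟫`, so `γ°(ν) = ⟪p, ν⟫`, `Dγ°(ν) = p`, and `Dy = I - Dρ ⊗ p` is `I - X(ν)`.

For `k ≥ 2` the Euclidean distance to `∂U` has a `C²` extension `δ` across `∂U` whose gradient on
`∂U` is `ν` (`IsGraphDefining.exists_contDiffAt_signedDistance`). Thus `∇ρ = G / ⟪p, G⟫` with
`G = ∇δ ∘ y`, and the chain rule gives the formula for `D²ρ`.
-/

namespace GaugeDist

/-! ### Calculus of germs of class `C^{k,α}` -/

section Holder

open Asymptotics

universe u

section

variable {V W : Type u} [NormedAddCommGroup V] [NormedAddCommGroup W] {α : ℝ≥0} {x : V}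

/-- `f` is `α`-Hölder continuous on some neighbourhood of `x`. For `α = 0` this says that `f` has
finite oscillation near `x`. -/
def HolderAt (α : ℝ≥0) (f : V → W) (x : V) : Prop :=
  (fun p : V × V => f p.1 - f p.2) =O[𝓝 (x, x)] fun p => ‖p.1 - p.2‖ ^ (α : ℝ)

theorem HolderAt.congr {f g : V → W} (hf : HolderAt α f x) (h : f =ᶠ[𝓝 x] g) :
    HolderAt α g x := by
  refine IsBigO.congr' hf ?_ EventuallyEq.rfl
  rw [nhds_prod_eq]
  filter_upwards [h.prod_mk h] with p hp
  rw [hp.1, hp.2]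

theorem holderAt_congr_norm {W' : Type u} [NormedAddCommGroup W'] {f : V → W} {g : V → W'}
    (h : ∀ y z, ‖f y - f z‖ = ‖g y - g z‖) : HolderAt α f x ↔ HolderAt α g x :=
  ⟨fun H => (H.norm_left.congr_left fun p => h p.1 p.2).of_norm_left,
    fun H => (H.norm_left.congr_left fun p => (h p.1 p.2).symm).of_norm_left⟩

theorem HolderAt.add {f g : V → W} (hf : HolderAt α f x) (hg : HolderAt α g x) :
    HolderAt α (fun y => f y + g y) x :=
  (IsBigO.add hf hg).congr_left fun _ => (add_sub_add_comm _ _ _ _).symm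

theorem tendsto_prodMk_of_continuousAt {f : V → W} (hf : ContinuousAt f x) :
    Tendsto (fun p : V × V => (f p.1, f p.2)) (𝓝 (x, x)) (𝓝 (f x, f x)) :=
  (hf.comp (x := (x, x)) continuousAt_fst).prodMk_nhds (hf.comp (x := (x, x)) continuousAt_snd)

/-- Near the diagonal, distances are at most `1`, so Lipschitz functions are `α`-Hölder. -/
theorem isBigO_norm_sub_rpow (hα : α ≤ 1) (x : V) :
    (fun p : V × V => p.1 - p.2) =O[𝓝 (x, x)] fun p => ‖p.1 - p.2‖ ^ (α : ℝ) := by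
  refine IsBigO.of_bound 1 ?_
  have hc : Tendsto (fun p : V × V => ‖p.1 - p.2‖) (𝓝 (x, x)) (𝓝 0) := by
    have : Continuous fun p : V × V => ‖p.1 - p.2‖ := by fun_prop
    simpa using this.tendsto (x, x)
  filter_upwards [hc.eventually (ge_mem_nhds one_pos)] with p hp
  rw [one_mul, Real.norm_of_nonneg (by positivity)]
  rcases eq_or_lt_of_le (norm_nonneg (p.1 - p.2)) with h | h
  · rw [← h]; positivity
  · simpa using Real.rpow_le_rpow_of_exponent_ge h hp (show (α : ℝ) ≤ 1 by exact_mod_cast hα)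

theorem HolderAt.bilinear {W₁ W₂ W₃ : Type u} [NormedAddCommGroup W₁] [NormedSpace ℝ W₁]
    [NormedAddCommGroup W₂] [NormedSpace ℝ W₂] [NormedAddCommGroup W₃] [NormedSpace ℝ W₃]
    (B : W₁ →L[ℝ] W₂ →L[ℝ] W₃) {f : V → W₁} {g : V → W₂} (hf : HolderAt α f x)
    (hg : HolderAt α g x) (hfc : ContinuousAt f x) (hgc : ContinuousAt g x) :
    HolderAt α (fun y => B (f y) (g y)) x := by
  have h1 : (fun p : V × V => B (f p.1 - f p.2) (g p.1)) =O[𝓝 (x, x)]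
      fun p => ‖p.1 - p.2‖ ^ (α : ℝ) := by
    have hb := (hgc.comp (x := (x, x)) continuousAt_fst).isBigO_one ℝ
    refine (IsBigO.trans ?_ (IsBigO.mul hf.norm_left hb.norm_left)).congr_right
      fun p => mul_one _
    refine IsBigO.of_bound ‖B‖ (Eventually.of_forall fun p => ?_)
    simpa [mul_assoc] using B.le_opNorm₂ (f p.1 - f p.2) (g p.1)
  have h2 : (fun p : V × V => B (f p.2) (g p.1 - g p.2)) =O[𝓝 (x, x)]
      fun p => ‖p.1 - p.2‖ ^ (α : ℝ) := by
    have hb := (hfc.comp (x := (x, x)) continuousAt_snd).isBigO_one ℝ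
    refine (IsBigO.trans ?_ (IsBigO.mul hb.norm_left hg.norm_left)).congr_right
      fun p => one_mul _
    refine IsBigO.of_bound ‖B‖ (Eventually.of_forall fun p => ?_)
    simpa [mul_assoc] using B.le_opNorm₂ (f p.2) (g p.1 - g p.2)
  refine (h1.add h2).congr_left fun p => ?_
  simp

end

variable {V W Z : Type u} [NormedAddCommGroup V] [NormedSpace ℝ V]
  [NormedAddCommGroup W] [NormedSpace ℝ W] [NormedAddCommGroup Z] [NormedSpace ℝ Z]
  {α : ℝ≥0} {k : ℕ} {x : V}

/-- `f` is of class `C^{k,α}` on some neighbourhood of `x`. -/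
def CkHolderAt (k : ℕ) (α : ℝ≥0) (f : V → W) (x : V) : Prop :=
  ContDiffAt ℝ k f x ∧ HolderAt α (iteratedFDeriv ℝ k f) x

theorem holderAt_of_contDiffAt (hα : α ≤ 1) {f : V → W} (hf : ContDiffAt ℝ 1 f x) :
    HolderAt α f x :=
  (hf.hasStrictFDerivAt one_ne_zero).isBigO_sub.trans (isBigO_norm_sub_rpow hα x)

theorem HolderAt.comp {g : V → W} {f : W → Z} (hf : HolderAt α f (g x)) (hg : HolderAt α g x)
    (hgc : ContinuousAt g x) (h : ContDiffAt ℝ 1 f (g x) ∨ ContDiffAt ℝ 1 g x) :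
    HolderAt α (fun y => f (g y)) x := by
  have ht := tendsto_prodMk_of_continuousAt hgc
  rcases h with h | h
  · exact ((h.hasStrictFDerivAt one_ne_zero).isBigO_sub.comp_tendsto ht).trans hg
  · refine (IsBigO.comp_tendsto hf ht).trans ?_
    exact IsBigO.rpow α.2 (Eventually.of_forall fun _ => norm_nonneg _)
      (h.hasStrictFDerivAt one_ne_zero).isBigO_sub.norm_norm

theorem ckHolderAt_zero_iff {f : V → W} :
    CkHolderAt 0 α f x ↔ ContDiffAt ℝ 0 f x ∧ HolderAt α f x := by
  unfold CkHolderAt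
  refine and_congr Iff.rfl (holderAt_congr_norm fun y z => ?_)
  rw [iteratedFDeriv_zero_eq_comp, Function.comp_apply, Function.comp_apply, ← map_sub,
    LinearIsometryEquiv.norm_map]

theorem CkHolderAt.congr {f g : V → W} (hf : CkHolderAt k α f x) (h : f =ᶠ[𝓝 x] g) :
    CkHolderAt k α g x :=
  ⟨hf.1.congr_of_eventuallyEq h.symm, hf.2.congr (h.iteratedFDeriv ℝ k)⟩

theorem ckHolderAt_succ_iff {f : V → W} :
    CkHolderAt (k + 1) α f x ↔ ContDiffAt ℝ (k + 1) f x ∧ CkHolderAt k α (fderiv ℝ f) x := by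
  have e' : HolderAt α (iteratedFDeriv ℝ (k + 1) f) x ↔
      HolderAt α (iteratedFDeriv ℝ k (fderiv ℝ f)) x := by
    refine holderAt_congr_norm fun y z => ?_
    rw [iteratedFDeriv_succ_eq_comp_right, iteratedFDeriv_succ_eq_comp_right]
    simp only [Function.comp_apply]
    rw [← dist_eq_norm, LinearIsometryEquiv.dist_map, dist_eq_norm]
  unfold CkHolderAt
  rw [e']
  push_cast
  exact ⟨fun h => ⟨h.1, h.1.fderiv_right le_rfl, h.2⟩, fun h => ⟨h.1, h.2.2⟩⟩

theorem CkHolderAt.succ {f : V → W} {f' : V → V →L[ℝ] W}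
    (hf : ∀ᶠ y in 𝓝 x, HasFDerivAt f (f' y) y) (hf' : CkHolderAt k α f' x) :
    CkHolderAt (k + 1) α f x :=
  ckHolderAt_succ_iff.2
    ⟨contDiffAt_succ_iff_hasFDerivAt.2 ⟨f', ⟨_, hf, fun _ h => h⟩, hf'.1⟩,
      hf'.congr (hf.mono fun _ h => h.fderiv.symm)⟩

theorem ckHolderAt_of_contDiffAt (hα : α ≤ 1) {f : V → W} (hf : ContDiffAt ℝ (k + 1) f x) :
    CkHolderAt k α f x :=
  ⟨hf.of_le (by exact_mod_cast k.le_succ), holderAt_of_contDiffAt hα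
    (hf.iteratedFDeriv_right (by rw [add_comm]))⟩

theorem CkHolderAt.of_succ (hα : α ≤ 1) {f : V → W} (hf : CkHolderAt (k + 1) α f x) :
    CkHolderAt k α f x :=
  ckHolderAt_of_contDiffAt hα (by exact_mod_cast hf.1)

theorem CkHolderAt.add {f g : V → W} (hf : CkHolderAt k α f x) (hg : CkHolderAt k α g x) :
    CkHolderAt k α (fun y => f y + g y) x := by
  refine ⟨hf.1.add hg.1, (hf.2.add hg.2).congr ?_⟩
  have h1 := hf.1.eventually (by simp)
  have h2 := hg.1.eventually (by simp)
  filter_upwards [h1, h2] with y hy hy'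
  exact (iteratedFDeriv_add_apply hy hy').symm

theorem CkHolderAt.bilinear (hα : α ≤ 1) {W₁ W₂ W₃ : Type u}
    [NormedAddCommGroup W₁] [NormedSpace ℝ W₁]
    [NormedAddCommGroup W₂] [NormedSpace ℝ W₂] [NormedAddCommGroup W₃] [NormedSpace ℝ W₃]
    (B : W₁ →L[ℝ] W₂ →L[ℝ] W₃) {f : V → W₁} {g : V → W₂} (hf : CkHolderAt k α f x)
    (hg : CkHolderAt k α g x) : CkHolderAt k α (fun y => B (f y) (g y)) x := by
  induction k generalizing W₁ W₂ W₃ with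
  | zero =>
    rw [ckHolderAt_zero_iff] at *
    exact ⟨(B.isBoundedBilinearMap.contDiff.contDiffAt).comp x (hf.1.prodMk hg.1),
      hf.2.bilinear B hg.2 hf.1.continuousAt hg.1.continuousAt⟩
  | succ k ih =>
    have hf' := (ckHolderAt_succ_iff.1 hf).2
    have hg' := (ckHolderAt_succ_iff.1 hg).2
    have hd1 := hf.1.eventually (by simp)
    have hd2 := hg.1.eventually (by simp)
    refine CkHolderAt.succ (f' := fun y => B.precompR V (f y) (fderiv ℝ g y) +
      B.precompL V (fderiv ℝ f y) (g y)) ?_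
      ((ih (B.precompR V) (hf.of_succ hα) hg').add (ih (B.precompL V) hf' (hg.of_succ hα)))
    filter_upwards [hd1, hd2] with y h1 h2
    exact B.hasFDerivAt_of_bilinear (h1.differentiableAt (by simp)).hasFDerivAt
      (h2.differentiableAt (by simp)).hasFDerivAt

/-- Composition of germs of class `C^{k,α}`. One of the maps has to be `C¹`, which matters only
for `k = 0`. -/
theorem CkHolderAt.comp (hα : α ≤ 1) {g : V → W} {f : W → Z} (hf : CkHolderAt k α f (g x))
    (hg : CkHolderAt k α g x) (h : ContDiffAt ℝ 1 f (g x) ∨ ContDiffAt ℝ 1 g x) :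
    CkHolderAt k α (fun y => f (g y)) x := by
  induction k generalizing Z with
  | zero =>
    rw [ckHolderAt_zero_iff] at *
    exact ⟨hf.1.comp x hg.1, hf.2.comp hg.2 hg.1.continuousAt h⟩
  | succ k ih =>
    have hg1 : ContDiffAt ℝ 1 g x := hg.1.of_le (by exact_mod_cast Nat.le_add_left 1 k)
    have hf' := ih (ckHolderAt_succ_iff.1 hf).2 (hg.of_succ hα) (Or.inr hg1)
    have hd1 := hf.1.eventually (by simp)
    have hd2 := hg.1.eventually (by simp)
    refine CkHolderAt.succ (f' := fun y => ContinuousLinearMap.compL ℝ V W Z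
      (fderiv ℝ f (g y)) (fderiv ℝ g y)) ?_ (hf'.bilinear hα _ (ckHolderAt_succ_iff.1 hg).2)
    filter_upwards [hg.1.continuousAt.eventually hd1, hd2] with y h1 h2
    exact (h1.differentiableAt (by simp)).hasFDerivAt.comp y
      (h2.differentiableAt (by simp)).hasFDerivAt

theorem CkHolderAt.contDiffAt_comp (hα : α ≤ 1) {g : V → W} {f : W → Z}
    (hf : ContDiffAt ℝ (k + 1) f (g x)) (hg : CkHolderAt k α g x) :
    CkHolderAt k α (fun y => f (g y)) x :=
  (ckHolderAt_of_contDiffAt hα hf).comp hα hg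
    (Or.inl (hf.of_le (by exact_mod_cast Nat.le_add_left 1 k)))

theorem CkHolderAt.inv_smul (hα : α ≤ 1) {f : V → W} (hf : CkHolderAt k α f x)
    (l : W →L[ℝ] ℝ) (hl : l (f x) ≠ 0) : CkHolderAt k α (fun y => (l (f y))⁻¹ • f y) x := by
  have : ContDiffAt ℝ (k + 1) (fun w : W => (l w)⁻¹ • w) (f x) :=
    (l.contDiff.contDiffAt.inv hl).smul contDiffAt_id
  exact hf.contDiffAt_comp (f := fun w : W => (l w)⁻¹ • w) hα this

theorem IsCkHolderOn.ckHolderAt {f : V → W} {s : Set V} (hf : IsCkHolderOn k α f s)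
    (hs : s ∈ 𝓝 x) : CkHolderAt k α f x := by
  obtain ⟨h1, C, h2⟩ := hf
  refine ⟨h1.contDiffAt hs, IsBigO.of_bound C ?_⟩
  filter_upwards [prod_mem_nhds hs hs] with p hp
  rw [Real.norm_of_nonneg (by positivity), ← dist_eq_norm, ← dist_eq_norm]
  exact h2.dist_le hp.1 hp.2

theorem CkHolderAt.eventually_isCkHolderOn {f : V → W} (hf : CkHolderAt k α f x) :
    ∀ᶠ r in 𝓝[>] (0 : ℝ), IsCkHolderOn k α f (Metric.ball x r) := by
  obtain ⟨h1, h2⟩ := hf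
  obtain ⟨C, hC⟩ := h2.bound
  rw [nhds_prod_eq] at hC
  obtain ⟨t, ht, hC⟩ := mem_prod_same_iff.1 hC
  obtain ⟨ε, hε, hb⟩ := Metric.mem_nhds_iff.1
    (inter_mem ht (h1.eventually (by simp)))
  filter_upwards [Ioo_mem_nhdsGT hε] with r hr
  have hsub := (Metric.ball_subset_ball (x := x) hr.2.le).trans hb
  refine ⟨fun y hy => ContDiffAt.contDiffWithinAt (hsub hy).2, C.toNNReal, ?_⟩
  intro y hy z hz
  have : ‖_‖ ≤ C * ‖_‖ := hC (mk_mem_prod (hsub hy).1 (hsub hz).1)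
  rw [Real.norm_of_nonneg (by positivity), ← dist_eq_norm, ← dist_eq_norm] at this
  have h3 : dist (iteratedFDeriv ℝ k f y) (iteratedFDeriv ℝ k f z) ≤
      C.toNNReal * dist y z ^ (α : ℝ) :=
    this.trans (mul_le_mul_of_nonneg_right C.le_coe_toNNReal (by positivity))
  rw [edist_dist, edist_dist, ENNReal.ofReal_rpow_of_nonneg dist_nonneg α.coe_nonneg]
  refine (ENNReal.ofReal_le_ofReal h3).trans ?_
  rw [ENNReal.ofReal_mul (by positivity), ENNReal.ofReal_coe_nnreal]

end Holder

/-! ### Normal cones and the polar gauge -/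

section Convex

variable {E : Type*} [NormedAddCommGroup E] [InnerProductSpace ℝ E] {K : Set E} {p q v : E}

/-- A vector in the interior of the normal cone at `p` is normal to `K` at no other point. -/
theorem eq_of_mem_normalCone_of_mem_interior (hp : p ∈ K) (hq : q ∈ K)
    (hv : v ∈ interior (normalCone K p)) (hv' : v ∈ normalCone K q) : q = p := by
  have ht : Tendsto (fun t : ℝ => v + t • (q - p)) (𝓝[>] 0) (𝓝 v) := by
    have : Continuous fun t : ℝ => v + t • (q - p) := by fun_prop
    simpa using (this.tendsto 0).mono_left nhdsWithin_le_nhds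
  obtain ⟨t, ht, ht0⟩ := ((ht.eventually (mem_interior_iff_mem_nhds.1 hv)).and
    self_mem_nhdsWithin).exists
  have h1 : ⟪q - p, v + t • (q - p)⟫ ≤ 0 := ht q hq
  have h2 : ⟪p - q, v⟫ ≤ 0 := hv' p hp
  rw [inner_add_right, real_inner_smul_right, real_inner_self_eq_norm_sq] at h1
  rw [← neg_sub, inner_neg_left] at h2
  have h3 : t * ‖q - p‖ ^ 2 ≤ 0 := by linarith
  have h4 : ‖q - p‖ ^ 2 ≤ 0 := nonpos_of_mul_nonpos_right h3 ht0
  have h5 : ‖q - p‖ = 0 := by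
    have := sq_nonneg ‖q - p‖
    exact pow_eq_zero_iff two_ne_zero |>.1 (le_antisymm h4 this)
  exact sub_eq_zero.1 (norm_eq_zero.1 h5)

theorem inner_pos_of_mem_normalCone (h0 : K ∈ 𝓝 0) (hv : v ∈ normalCone K p) (hv0 : v ≠ 0) :
    0 < ⟪p, v⟫ := by
  have ht : Tendsto (fun t : ℝ => t • v) (𝓝[>] 0) (𝓝 0) := by
    have : Continuous fun t : ℝ => t • v := by fun_prop
    simpa using (this.tendsto 0).mono_left nhdsWithin_le_nhds
  obtain ⟨t, ht, ht0⟩ := ((ht.eventually h0).and self_mem_nhdsWithin).exists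
  have h1 : ⟪t • v - p, v⟫ ≤ 0 := hv _ ht
  rw [inner_sub_left, real_inner_smul_left, real_inner_self_eq_norm_sq] at h1
  have : 0 < t * ‖v‖ ^ 2 := mul_pos ht0 (by positivity)
  linarith

theorem polarGauge_eq_inner (h0 : K ∈ 𝓝 0) (hp : p ∈ K) (hv : v ∈ normalCone K p) (hv0 : v ≠ 0) :
    polarGauge K v = ⟪p, v⟫ := by
  have hpos := inner_pos_of_mem_normalCone h0 hv hv0
  have : {r : ℝ | r ∈ Ioi (0 : ℝ) ∧ r⁻¹ • v ∈ polarSet K} = Ici ⟪p, v⟫ := by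
    ext r
    simp only [polarSet, mem_ofPred_eq, mem_Ioi, mem_Ici, real_inner_smul_left]
    refine ⟨fun ⟨hr, h⟩ => ?_, fun h => ⟨hpos.trans_le h, fun y hy => ?_⟩⟩
    · have := h p hp
      rwa [inv_mul_le_iff₀ hr, mul_one, real_inner_comm] at this
    · rw [inv_mul_le_iff₀ (hpos.trans_le h), mul_one, real_inner_comm]
      have := hv y hy
      rw [inner_sub_left] at this
      linarith
  rw [polarGauge, gauge_def', this, csInf_Ici]

/-- On the normal cone at `p` the polar gauge is linear, so at an interior point its gradient
is `p`. -/
theorem hasGradientAt_polarGauge [CompleteSpace E] (h0 : K ∈ 𝓝 0) (hp : p ∈ K)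
    (hv : v ∈ interior (normalCone K p)) (hv0 : v ≠ 0) :
    HasGradientAt (polarGauge K) p v := by
  have h : HasFDerivAt (fun w => ⟪p, w⟫) (InnerProductSpace.toDual ℝ E p) v :=
    (InnerProductSpace.toDual ℝ E p).hasFDerivAt
  rw [hasGradientAt_iff_hasFDerivAt]
  refine h.congr_of_eventuallyEq ?_
  filter_upwards [mem_interior_iff_mem_nhds.1 hv, isOpen_ne.mem_nhds hv0] with w hw hw0
  exact polarGauge_eq_inner h0 hp hw hw0

end Convex

/-! ### The gauge distance and its closest points -/

section Rho

variable {E : Type*} [NormedAddCommGroup E] [InnerProductSpace ℝ E] {K U : Set E} {x y : E}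

theorem rho_le_gauge (hy : y ∈ frontier U) : rho K U x ≤ gauge K (x - y) :=
  csInf_le ⟨0, by rintro _ ⟨z, -, rfl⟩; exact gauge_nonneg _⟩ (mem_image_of_mem _ hy)

theorem exists_isRhoClosest (hK : Convex ℝ K) (h0 : K ∈ 𝓝 0) (hU : IsCompact (frontier U))
    (hne : (frontier U).Nonempty) (x : E) : ∃ y, IsRhoClosest K U x y := by
  have hc : Continuous fun y => gauge K (x - y) :=
    (continuous_gauge hK h0).comp (continuous_const.sub continuous_id)
  obtain ⟨y, hy, h⟩ := hU.exists_sInf_image_eq hne hc.continuousOn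
  exact ⟨y, hy, h⟩

theorem exists_lipschitzWith_rho (hK : Convex ℝ K) (h0 : K ∈ 𝓝 0) (hU : IsCompact (frontier U))
    (hne : (frontier U).Nonempty) : ∃ C, LipschitzWith C (rho K U) := by
  obtain ⟨C, hC⟩ := hK.lipschitz_gauge h0
  refine ⟨C, LipschitzWith.of_le_add_mul C fun x z => ?_⟩
  obtain ⟨y, hy, h⟩ := exists_isRhoClosest hK h0 hU hne z
  have h1 := hC.le_add_mul (x - y) (z - y)
  rw [dist_sub_right] at h1
  rw [h]
  exact (rho_le_gauge hy).trans h1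

/-- Closest points depend upper semicontinuously on the base point. -/
theorem IsUniqueRhoClosest.eventually_mem (hK : Convex ℝ K) (h0 : K ∈ 𝓝 0)
    (hU : IsCompact (frontier U)) (h : IsUniqueRhoClosest K U x y) {V : Set E} (hV : V ∈ 𝓝 y) :
    ∀ᶠ z in 𝓝 x, ∀ w, IsRhoClosest K U z w → w ∈ V := by
  obtain ⟨C, hC⟩ := exists_lipschitzWith_rho hK h0 hU ⟨y, h.1.1⟩
  have hcomp : IsCompact (frontier U \ interior V) := hU.diff isOpen_interior
  have key : ∀ᶠ z in 𝓝 x, ∀ w ∈ frontier U \ interior V, rho K U z < gauge K (z - w) := by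
    refine hcomp.eventually_forall_of_forall_eventually fun w hw => ?_
    have hc : Continuous fun q : E × E => gauge K (q.1 - q.2) :=
      (continuous_gauge hK h0).comp (continuous_fst.sub continuous_snd)
    have hr : Continuous fun q : E × E => rho K U q.1 := hC.continuous.comp continuous_fst
    refine hr.continuousAt.eventually_lt hc.continuousAt ?_
    refine lt_of_le_of_ne (rho_le_gauge hw.1) fun he => hw.2 ?_
    rw [h.2 w ⟨hw.1, he⟩]
    exact mem_interior_iff_mem_nhds.2 hV
  filter_upwards [key] with z hz w hw
  by_contra hwV
  exact (hz w ⟨hw.1, fun h => hwV (interior_subset h)⟩).ne hw.2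

theorem mem_of_gauge_sub_lt_rho (hK : Convex ℝ K) (h0 : K ∈ 𝓝 0) (hU : IsOpen U) (hx : x ∈ U)
    (h : gauge K (x - y) < rho K U x) : y ∈ U := by
  have hS : Convex ℝ {z | gauge K (x - z) < rho K U x} := by
    intro z hz w hw a b ha hb hab
    have e : x - (a • z + b • w) = a • (x - z) + b • (x - w) := by
      rw [smul_sub, smul_sub, sub_add_sub_comm, ← add_smul, hab, one_smul]
    have h1 := gauge_add_le hK (absorbent_nhds_zero h0) (a • (x - z)) (b • (x - w))
    rw [← e, gauge_smul_of_nonneg ha, gauge_smul_of_nonneg hb, smul_eq_mul, smul_eq_mul] at h1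
    refine h1.trans_lt ?_
    simp only [mem_ofPred_eq] at hz hw
    rcases ha.eq_or_lt with rfl | ha
    · obtain rfl : b = 1 := by linarith
      linarith
    · calc a * gauge K (x - z) + b * gauge K (x - w) < a * rho K U x + b * rho K U x :=
            add_lt_add_of_lt_of_le (mul_lt_mul_of_pos_left hz ha)
              (mul_le_mul_of_nonneg_left hw.le hb)
        _ = rho K U x := by rw [← add_mul, hab, one_mul]
  have hxS : x ∈ {z | gauge K (x - z) < rho K U x} := by
    simpa using (gauge_nonneg _).trans_lt h
  refine hS.isPreconnected.subset_of_closure_inter_subset hU ⟨x, hxS, hx⟩ ?_ h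
  rintro z ⟨hz, hz'⟩
  by_contra hzU
  have : z ∈ frontier U := ⟨hz, by rwa [hU.interior_eq]⟩
  exact absurd hz' (not_lt.2 (rho_le_gauge this))

theorem IsRhoClosest.rho_pos (h0 : K ∈ 𝓝 0) (hb : Bornology.IsBounded K) (hU : IsOpen U)
    (hx : x ∈ U) (h : IsRhoClosest K U x y) : 0 < rho K U x := by
  rw [h.2, gauge_pos (absorbent_nhds_zero h0) (NormedSpace.isVonNBounded_iff ℝ |>.2 hb),
    sub_ne_zero]
  rintro rfl
  have := h.1.2
  rw [hU.interior_eq] at this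
  exact this hx

theorem IsRhoClosest.inv_smul_mem (hK : Convex ℝ K) (h0 : K ∈ 𝓝 0) (hcl : IsClosed K)
    (h : IsRhoClosest K U x y) : (rho K U x)⁻¹ • (x - y) ∈ K := by
  refine hcl.closure_subset ((gauge_le_one_iff_mem_closure hK h0).1 ?_)
  have hn : 0 ≤ rho K U x := h.2 ▸ gauge_nonneg _
  rw [gauge_smul_of_nonneg (inv_nonneg.2 hn), ← h.2, smul_eq_mul]
  exact inv_mul_le_one

end Rho

/-! ### Domains above a graph -/

section Graph

/-- On the open set `s`, the set `U` is the superlevel set `{F > 0}` of the `C¹` function `F`, and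
`F` grows with unit speed in the direction `e`. If `U` lies above the graph of `g` in the direction
`e`, then `F z = ⟪e, z⟫ - g (z')`, with `z'` the component of `z` orthogonal to `e`. -/
structure IsGraphDefining {E : Type*} [NormedAddCommGroup E] [NormedSpace ℝ E]
    (U s : Set E) (e : E) (F : E → ℝ) : Prop where
  isOpen : IsOpen s
  add_smul : ∀ z (t : ℝ), F (z + t • e) = F z + t
  contDiffAt : ∀ z ∈ s, ContDiffAt ℝ 1 F z
  mem_iff : ∀ z ∈ s, z ∈ U ↔ 0 < F z

theorem HasCkHolderBoundary.exists_isGraphDefining {E : Type} [NormedAddCommGroup E]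
    [InnerProductSpace ℝ E] {U : Set E} {k : ℕ} (hk : 1 ≤ k) {α : ℝ≥0} (hα : α ≤ 1)
    (hU : HasCkHolderBoundary k α U) {p : E} (hp : p ∈ frontier U) :
    ∃ e s F, p ∈ s ∧ IsGraphDefining U s e F ∧ ∀ z ∈ s, CkHolderAt k α F z := by
  obtain ⟨e, he, g, r, hr, hg, hgU⟩ := hU p hp
  set π := (ℝ ∙ e)ᗮ.orthogonalProjectionOnto
  have hF : ∀ z ∈ Metric.ball p r, CkHolderAt k α (fun z => ⟪e, z⟫ - g (π z)) z := by
    intro z hz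
    have hπ : π z ∈ Metric.ball (π p) r := by
      rw [mem_ball_iff_norm, ← map_sub]
      exact (Submodule.norm_orthogonalProjectionOnto_apply_le _ _).trans_lt
        (mem_ball_iff_norm.1 hz)
    have h1 : CkHolderAt k α (fun z => -g (π z)) z :=
      ((hg.ckHolderAt (Metric.isOpen_ball.mem_nhds hπ)).comp hα (g := π)
        (ckHolderAt_of_contDiffAt hα π.contDiff.contDiffAt)
        (Or.inr π.contDiff.contDiffAt)).contDiffAt_comp hα (f := fun t : ℝ => -t)
        contDiff_neg.contDiffAt
    have h2 : CkHolderAt k α (fun z => ⟪e, z⟫) z :=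
      ckHolderAt_of_contDiffAt hα (contDiff_const.inner ℝ contDiff_id).contDiffAt
    simpa only [sub_eq_add_neg] using h2.add h1
  refine ⟨e, Metric.ball p r, fun z => ⟪e, z⟫ - g (π z), Metric.mem_ball_self hr,
    ⟨Metric.isOpen_ball, fun z t => ?_, fun z hz => (hF z hz).1.of_le (by exact_mod_cast hk),
      fun z hz => ?_⟩, hF⟩
  · have : π e = 0 := Submodule.orthogonalProjectionOnto_orthogonalComplement_singleton_eq_zero e
    simp only [map_add, map_smul, this, smul_zero, add_zero, inner_add_right,
      real_inner_smul_right, real_inner_self_eq_norm_sq, he]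
    ring
  · rw [hgU z hz, sub_pos]

theorem tendsto_line {E : Type*} [NormedAddCommGroup E] [NormedSpace ℝ E]
    (y w : E) : Tendsto (fun t : ℝ => y + t • w) (𝓝[>] 0) (𝓝 y) := by
  have : Continuous fun t : ℝ => y + t • w := by fun_prop
  simpa using (this.tendsto 0).mono_left nhdsWithin_le_nhds

variable {E : Type*} [NormedAddCommGroup E] [InnerProductSpace ℝ E] [CompleteSpace E]
  {U s : Set E} {e y : E} {F : E → ℝ}

namespace IsGraphDefining

theorem hasFDerivAt (h : IsGraphDefining U s e F) (hy : y ∈ s) :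
    HasFDerivAt F (InnerProductSpace.toDual ℝ E (∇ F y)) y :=
  hasGradientAt_iff_hasFDerivAt.1
    ((h.contDiffAt y hy).differentiableAt one_ne_zero).hasGradientAt

theorem hasDerivAt_line (h : IsGraphDefining U s e F) (hy : y ∈ s) (w : E) :
    HasDerivAt (fun t : ℝ => F (y + t • w)) ⟪∇ F y, w⟫ 0 := by
  have h1 : HasDerivAt (fun t : ℝ => y + t • w) w 0 := by
    simpa using ((hasDerivAt_id (0 : ℝ)).smul_const w).const_add y
  have h2 : HasFDerivAt F (InnerProductSpace.toDual ℝ E (∇ F y)) (y + (0 : ℝ) • w) := by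
    simpa using h.hasFDerivAt hy
  exact h2.comp_hasDerivAt (0 : ℝ) h1

theorem inner_gradient (h : IsGraphDefining U s e F) (hy : y ∈ s) : ⟪∇ F y, e⟫ = 1 := by
  refine (h.hasDerivAt_line hy e).unique ?_
  simp only [h.add_smul]
  exact (hasDerivAt_id (0 : ℝ)).const_add _

theorem gradient_ne_zero (h : IsGraphDefining U s e F) (hy : y ∈ s) : ∇ F y ≠ 0 := by
  intro h0
  simpa [h0] using h.inner_gradient hy

theorem tendsto_slope (h : IsGraphDefining U s e F) (hy : y ∈ s) (hF : F y = 0) (w : E) :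
    Tendsto (fun t : ℝ => t⁻¹ * F (y + t • w)) (𝓝[>] 0) (𝓝 ⟪∇ F y, w⟫) := by
  simpa [hF] using (h.hasDerivAt_line hy w).tendsto_slope_zero_right

theorem eventually_mem_of_inner_pos (h : IsGraphDefining U s e F) (hy : y ∈ s) (hF : F y = 0)
    {w : E} (hw : 0 < ⟪∇ F y, w⟫) : ∀ᶠ t : ℝ in 𝓝[>] 0, y + t • w ∈ U := by
  filter_upwards [(h.tendsto_slope hy hF w).eventually (lt_mem_nhds hw),
    (tendsto_line y w).eventually (h.isOpen.mem_nhds hy), self_mem_nhdsWithin] with t h1 h2 h3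
  exact (h.mem_iff _ h2).2 (pos_of_mul_pos_right h1 (inv_nonneg.2 (le_of_lt h3)))

theorem inner_nonneg_of_eventually_mem (h : IsGraphDefining U s e F) (hy : y ∈ s) (hF : F y = 0)
    {w : E} (hw : ∀ᶠ t : ℝ in 𝓝[>] 0, y + t • w ∈ U) : 0 ≤ ⟪∇ F y, w⟫ := by
  refine ge_of_tendsto (h.tendsto_slope hy hF w) ?_
  filter_upwards [hw, (tendsto_line y w).eventually (h.isOpen.mem_nhds hy),
    self_mem_nhdsWithin] with t h1 h2 h3
  exact mul_nonneg (inv_nonneg.2 (le_of_lt h3)) ((h.mem_iff _ h2).1 h1).le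

theorem mem_frontier_iff (h : IsGraphDefining U s e F) (hU : IsOpen U) (hy : y ∈ s) :
    y ∈ frontier U ↔ F y = 0 := by
  have hc := (h.contDiffAt y hy).continuousAt
  rw [frontier, hU.interior_eq]
  refine ⟨fun ⟨h1, h2⟩ => ?_, fun hF => ⟨?_, ?_⟩⟩
  · rw [h.mem_iff y hy, not_lt] at h2
    refine h2.antisymm (not_lt.1 fun h3 => ?_)
    obtain ⟨z, ⟨hz1, hz2⟩, hzU⟩ := (mem_closure_iff_frequently.1 h1).and_eventually
      ((hc.eventually (gt_mem_nhds h3)).and (h.isOpen.mem_nhds hy)) |>.exists.imp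
        fun z hz => And.intro hz.2 hz.1
    exact absurd ((h.mem_iff z hz2).1 hzU) hz1.not_gt
  · exact mem_closure_of_tendsto (tendsto_line y e) (h.eventually_mem_of_inner_pos hy hF
      (by rw [h.inner_gradient hy]; exact one_pos))
  · rw [h.mem_iff y hy, hF]; exact lt_irrefl 0

/-- Vectors orthogonal to the gradient are tangent to `∂U`: along such a vector the points of the
line are pushed back onto `∂U` in the direction `e`, by an amount of smaller order. -/
theorem mem_tangentConeAt_of_inner_eq_zero (h : IsGraphDefining U s e F) (hU : IsOpen U)
    (hy : y ∈ s) (hF : F y = 0) {w : E} (hw : ⟪∇ F y, w⟫ = 0) :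
    w ∈ tangentConeAt ℝ (frontier U) y := by
  have hs := h.tendsto_slope hy hF w
  rw [hw] at hs
  have hcd : Tendsto (fun t : ℝ => t⁻¹ • (t • w - F (y + t • w) • e)) (𝓝[>] 0) (𝓝 w) := by
    have : Tendsto (fun t : ℝ => w - (t⁻¹ * F (y + t • w)) • e) (𝓝[>] 0)
        (𝓝 (w - (0 : ℝ) • e)) := tendsto_const_nhds.sub (hs.smul_const e)
    rw [zero_smul, sub_zero] at this
    refine this.congr' ?_
    filter_upwards [self_mem_nhdsWithin] with t ht
    rw [smul_sub, smul_smul, smul_smul, inv_mul_cancel₀ (ne_of_gt ht), one_smul]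
  have hd : Tendsto (fun t : ℝ => t • w - F (y + t • w) • e) (𝓝[>] 0) (𝓝 0) := by
    have h0 : Tendsto (fun t : ℝ => t) (𝓝[>] 0) (𝓝 0) :=
      tendsto_id.mono_left nhdsWithin_le_nhds
    have := h0.smul hcd
    rw [zero_smul] at this
    refine this.congr' ?_
    filter_upwards [self_mem_nhdsWithin] with t ht
    rw [smul_smul, mul_inv_cancel₀ (ne_of_gt ht), one_smul]
  refine mem_tangentConeAt_of_seq (𝓝[>] (0 : ℝ)) (fun t => t⁻¹) _ hd ?_ hcd
  have h1 : Tendsto (fun t : ℝ => y + (t • w - F (y + t • w) • e)) (𝓝[>] 0) (𝓝 y) := by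
    simpa using hd.const_add y
  filter_upwards [h1.eventually (h.isOpen.mem_nhds hy)] with t ht
  refine (h.mem_frontier_iff hU ht).2 ?_
  rw [show y + (t • w - F (y + t • w) • e) = (y + t • w) + (-F (y + t • w)) • e by
    rw [neg_smul]; abel, h.add_smul, add_neg_cancel]

theorem inner_eq_zero_of_mem_tangentConeAt (h : IsGraphDefining U s e F) (hU : IsOpen U)
    (hy : y ∈ s) (hF : F y = 0) {w : E} (hw : w ∈ tangentConeAt ℝ (frontier U) y) :
    ⟪∇ F y, w⟫ = 0 := by
  have h0 : HasFDerivWithinAt F (0 : E →L[ℝ] ℝ) (frontier U) y := by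
    refine (hasFDerivWithinAt_const (0 : ℝ) y (frontier U)).congr_of_eventuallyEq ?_ hF
    filter_upwards [self_mem_nhdsWithin, mem_nhdsWithin_of_mem_nhds (h.isOpen.mem_nhds hy)]
      with z hz hzs
    exact (h.mem_frontier_iff hU hzs).1 hz
  simpa using (h.hasFDerivAt hy).hasFDerivWithinAt.unique_on h0 hw

theorem isInwardUnitNormal (h : IsGraphDefining U s e F) (hU : IsOpen U)
    (hy : y ∈ s) (hF : F y = 0) : IsInwardUnitNormal U y (‖∇ F y‖⁻¹ • ∇ F y) := by
  have hn := norm_pos_iff.2 (h.gradient_ne_zero hy)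
  refine ⟨norm_smul_inv_norm (𝕜 := ℝ) (h.gradient_ne_zero hy), fun w hw => ?_, ?_⟩
  · rw [real_inner_smul_left, h.inner_eq_zero_of_mem_tangentConeAt hU hy hF hw, mul_zero]
  · refine h.eventually_mem_of_inner_pos hy hF ?_
    rw [real_inner_smul_right, real_inner_self_eq_norm_sq]
    positivity

theorem eq_of_isInwardUnitNormal (h : IsGraphDefining U s e F) (hU : IsOpen U)
    (hy : y ∈ s) (hF : F y = 0) {v : E} (hv : IsInwardUnitNormal U y v) :
    v = ‖∇ F y‖⁻¹ • ∇ F y := by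
  obtain ⟨hv1, hv2, hv3⟩ := hv
  have hn := norm_pos_iff.2 (h.gradient_ne_zero hy)
  set c := ⟪∇ F y, v⟫ / ‖∇ F y‖ ^ 2
  have hw : ⟪∇ F y, v - c • ∇ F y⟫ = 0 := by
    rw [inner_sub_right, real_inner_smul_right, real_inner_self_eq_norm_sq,
      div_mul_cancel₀ _ (by positivity), sub_self]
  have hw2 := hv2 _ (h.mem_tangentConeAt_of_inner_eq_zero hU hy hF hw)
  have hw3 : ⟪v - c • ∇ F y, v - c • ∇ F y⟫ = 0 := by
    rw [inner_sub_left, hw2, real_inner_smul_left, hw, mul_zero, sub_zero]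
  have hvc : v = c • ∇ F y := sub_eq_zero.1 (inner_self_eq_zero.1 hw3)
  have hc : 0 ≤ c := div_nonneg (h.inner_nonneg_of_eventually_mem hy hF hv3) (by positivity)
  have hcn : c * ‖∇ F y‖ = 1 := by
    rw [← hv1, hvc, norm_smul, Real.norm_of_nonneg hc]
  rw [hvc, eq_inv_of_mul_eq_one_left hcn]

theorem inwardNormal_eq (h : IsGraphDefining U s e F) (hU : IsOpen U)
    (hy : y ∈ s) (hyU : y ∈ frontier U) : inwardNormal U y = ‖∇ F y‖⁻¹ • ∇ F y := by
  have hF := (h.mem_frontier_iff hU hy).1 hyU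
  have hex : ∃ v, IsInwardUnitNormal U y v := ⟨_, h.isInwardUnitNormal hU hy hF⟩
  rw [inwardNormal, dif_pos hex]
  exact h.eq_of_isInwardUnitNormal hU hy hF hex.choose_spec

theorem uniqueDiffWithinAt_closure (h : IsGraphDefining U s e F) (hU : IsOpen U)
    (hy : y ∈ s) (hyU : y ∈ closure U) : UniqueDiffWithinAt ℝ (closure U) y := by
  by_cases hyU' : y ∈ U
  · exact uniqueDiffWithinAt_of_mem_nhds (mem_of_superset (hU.mem_nhds hyU') subset_closure)
  have hF : F y = 0 := (h.mem_frontier_iff hU hy).1 ⟨hyU, by rwa [hU.interior_eq]⟩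
  refine ⟨?_, subset_closure hyU⟩
  have hpos : ∀ w, 0 < ⟪∇ F y, w⟫ → w ∈ tangentConeAt ℝ (closure U) y := fun w hw =>
    mem_tangentConeAt_of_add_smul_mem (c := fun t : ℝ => t)
      (tendsto_id.mono_left (nhdsGT_le_nhdsNE 0))
      ((h.eventually_mem_of_inner_pos hy hF hw).mono fun t ht => subset_closure ht)
  have he := h.inner_gradient hy
  have : Submodule.span ℝ (tangentConeAt ℝ (closure U) y) = ⊤ := by
    refine eq_top_iff.2 fun w _ => ?_
    -- A vector is a difference of two vectors of the open half-space of inner directions.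
    have h1 : w + (1 + |⟪∇ F y, w⟫|) • e ∈ tangentConeAt ℝ (closure U) y := by
      refine hpos _ ?_
      rw [inner_add_right, real_inner_smul_right, he]
      linarith [neg_abs_le ⟪∇ F y, w⟫]
    have h2 : e ∈ tangentConeAt ℝ (closure U) y := hpos e (by rw [he]; exact one_pos)
    have := Submodule.sub_mem _ (Submodule.subset_span h1)
      (Submodule.smul_mem _ (1 + |⟪∇ F y, w⟫|) (Submodule.subset_span h2))
    simpa using this
  rw [this]
  exact dense_univ

/-- At a closest point `y` to `x`, the inward normal of `U` is an outer normal of the set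
`x - ρ(x) K`, which touches `∂U` from inside at `y`. -/
theorem gradient_mem_normalCone {K : Set E} {x : E} (h : IsGraphDefining U s e F) (hU : IsOpen U)
    (hy : y ∈ s) (hK : Convex ℝ K) (h0 : K ∈ 𝓝 0) (hx : x ∈ U) (hρ : 0 < rho K U x)
    (hxy : IsRhoClosest K U x y) :
    ∇ F y ∈ normalCone K ((rho K U x)⁻¹ • (x - y)) := by
  have hF := (h.mem_frontier_iff hU hy).1 hxy.1
  set ρ := rho K U x
  -- Points `a • z` with `z ∈ K` and `a < 1` lie in the interior of `K`.
  have key : ∀ z ∈ K, ∀ a ∈ Ioo (0 : ℝ) 1, 0 ≤ ⟪∇ F y, (x - y) - (ρ * a) • z⟫ := by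
    intro z hz a ha
    refine h.inner_nonneg_of_eventually_mem hy hF ?_
    filter_upwards [Ioo_mem_nhdsGT one_pos] with t ht
    refine mem_of_gauge_sub_lt_rho hK h0 hU hx ?_
    have e1 : x - (y + t • (x - y - (ρ * a) • z)) = (1 - t) • (x - y) + (t * (ρ * a)) • z := by
      module
    rw [e1]
    refine (gauge_add_le hK (absorbent_nhds_zero h0) _ _).trans_lt ?_
    have ht1 : 0 ≤ 1 - t := by linarith [ht.2]
    have hta : 0 ≤ t * (ρ * a) := mul_nonneg ht.1.le (mul_nonneg hρ.le ha.1.le)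
    rw [gauge_smul_of_nonneg ht1, gauge_smul_of_nonneg hta, ← hxy.2, smul_eq_mul, smul_eq_mul]
    have h1 := mul_le_mul_of_nonneg_left (gauge_le_one_of_mem hz) hta
    have h2 : 0 < t * ρ * (1 - a) := mul_pos (mul_pos ht.1 hρ) (by linarith [ha.2])
    change (1 - t) * ρ + _ < ρ
    linarith
  intro z hz
  have hlim : Tendsto (fun a : ℝ => ⟪∇ F y, (x - y) - (ρ * a) • z⟫) (𝓝[<] 1)
      (𝓝 ⟪∇ F y, (x - y) - (ρ * 1) • z⟫) := by
    have : Continuous fun a : ℝ => ⟪∇ F y, (x - y) - (ρ * a) • z⟫ := by fun_prop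
    exact (this.tendsto 1).mono_left nhdsWithin_le_nhds
  have hge := ge_of_tendsto hlim
    (by filter_upwards [Ioo_mem_nhdsLT one_pos] with a ha using key z hz a ha)
  have e2 : z - ρ⁻¹ • (x - y) = -ρ⁻¹ • ((x - y) - (ρ * 1) • z) := by
    have e3 : -ρ⁻¹ • ((x - y) - (ρ * 1) • z) = (ρ⁻¹ * ρ) • z - ρ⁻¹ • (x - y) := by module
    rw [e3, inv_mul_cancel₀ hρ.ne', one_smul]
  rw [e2, real_inner_smul_left, real_inner_comm]
  have := mul_nonneg (inv_nonneg.2 hρ.le) hge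
  linarith

end IsGraphDefining

end Graph

/-! ### The Euclidean distance near the boundary -/

section SignedDistance

variable {E : Type*} [NormedAddCommGroup E] [InnerProductSpace ℝ E]
  {U s : Set E} {e y : E} {F : E → ℝ}

theorem rho_closedBall (U : Set E) (x : E) :
    rho (Metric.closedBall 0 1) U x = bdryDist U x := by
  rw [rho, bdryDist, Metric.infDist_eq_iInf, sInf_image']
  simp only [gauge_closedBall zero_le_one, div_one, dist_eq_norm]

theorem exists_contDiffAt_localInverse [CompleteSpace E] {Φ : E → E} {L : E ≃L[ℝ] E}
    (hΦ : ContDiffAt ℝ 1 Φ y) (hL : HasFDerivAt Φ (L : E →L[ℝ] E) y) (hy : Φ y = y) :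
    ∃ Ψ : E → E, ContDiffAt ℝ 1 Ψ y ∧ Ψ y = y ∧ (∀ᶠ x in 𝓝 y, Φ (Ψ x) = x) ∧
      ∀ᶠ x in 𝓝 y, Ψ (Φ x) = x := by
  have hs := hΦ.hasStrictFDerivAt' hL one_ne_zero
  refine ⟨hΦ.localInverse hL one_ne_zero, ?_, ?_, ?_, hs.eventually_left_inverse⟩
  · simpa only [hy] using hΦ.to_localInverse hL one_ne_zero
  · have : hΦ.localInverse hL one_ne_zero (Φ y) = y := hs.localInverse_apply_image
    rwa [hy] at this
  · have := hs.eventually_right_inverse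
    rw [hy] at this
    exact this

/-- The map `z ↦ z + l(z) a` is invertible when `1 + l(a) ≠ 0`. -/
theorem exists_equiv_id_add_smulRight (l : E →L[ℝ] ℝ) (a : E) (h : 1 + l a ≠ 0) :
    ∃ L : E ≃L[ℝ] E, (L : E →L[ℝ] E) = ContinuousLinearMap.id ℝ E + l.smulRight a := by
  refine ⟨ContinuousLinearEquiv.equivOfInverse (ContinuousLinearMap.id ℝ E + l.smulRight a)
    (ContinuousLinearMap.id ℝ E - (1 + l a)⁻¹ • l.smulRight a) (fun z => ?_) (fun z => ?_), rfl⟩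
  · have : z + l z • a - ((1 + l a)⁻¹ * (l z + l z * l a)) • a = z := by
      rw [show l z + l z * l a = (1 + l a) * l z by ring, inv_mul_cancel_left₀ h]
      abel
    simpa [smul_smul] using this
  · have : z - ((1 + l a)⁻¹ * l z) • a + (l z - (1 + l a)⁻¹ * l z * l a) • a = z := by
      have : l z - (1 + l a)⁻¹ * l z * l a = (1 + l a)⁻¹ * l z := by
        field_simp
        ring
      rw [this]
      abel
    simpa [smul_smul] using this

theorem IsGraphDefining.apply_sub_smul (h : IsGraphDefining U s e F) (z : E) :
    F (z - F z • e) = 0 := by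
  rw [sub_eq_add_neg, ← neg_smul, h.add_smul, add_neg_cancel]

variable [CompleteSpace E]

theorem contDiffAt_gradient {f : E → ℝ} (hf : ContDiffAt ℝ 2 f y) : ContDiffAt ℝ 1 (∇ f) y :=
  ((InnerProductSpace.toDual ℝ E).symm : (E →L[ℝ] ℝ) ≃ₗᵢ[ℝ] E).contDiff.contDiffAt.comp y
    (hf.fderiv_right (by norm_num))

namespace IsGraphDefining

/-- A point of `U` is reached from its nearest boundary point along the inward normal. -/
theorem sub_eq_bdryDist_smul {x q : E} (h : IsGraphDefining U s e F) (hU : IsOpen U)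
    (hq : q ∈ s) (hx : x ∈ U) (hxq : IsRhoClosest (Metric.closedBall 0 1) U x q) :
    x - q = bdryDist U x • ‖∇ F q‖⁻¹ • ∇ F q := by
  have h0 : Metric.closedBall (0 : E) 1 ∈ 𝓝 0 := Metric.closedBall_mem_nhds 0 one_pos
  have hc : Convex ℝ (Metric.closedBall (0 : E) 1) := convex_closedBall 0 1
  have hρ := hxq.rho_pos h0 Metric.isBounded_closedBall hU hx
  have hn := h.gradient_mem_normalCone hU hq hc h0 hx hρ hxq
  have hp := hxq.inv_smul_mem hc h0 Metric.isClosed_closedBall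
  set p := (rho (Metric.closedBall 0 1) U x)⁻¹ • (x - q) with hpdef
  set n := ∇ F q
  have hn0 : 0 < ‖n‖ := norm_pos_iff.2 (h.gradient_ne_zero hq)
  have hN : ‖‖n‖⁻¹ • n‖ = 1 := norm_smul_inv_norm (𝕜 := ℝ) (h.gradient_ne_zero hq)
  rw [mem_closedBall_zero_iff] at hp
  have h1 : ⟪‖n‖⁻¹ • n - p, n⟫ ≤ 0 := hn _ (by rw [mem_closedBall_zero_iff, hN])
  have h2 : 1 ≤ ⟪p, ‖n‖⁻¹ • n⟫ := by
    have h3 : ⟪‖n‖⁻¹ • n - p, ‖n‖⁻¹ • n⟫ ≤ 0 := by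
      rw [real_inner_smul_right]
      exact mul_nonpos_of_nonneg_of_nonpos (inv_nonneg.2 hn0.le) h1
    rw [inner_sub_left, real_inner_self_eq_norm_sq, hN] at h3
    linarith
  have h3 : ‖p - ‖n‖⁻¹ • n‖ ^ 2 ≤ 0 := by
    rw [norm_sub_sq_real, hN]
    have : ‖p‖ ^ 2 ≤ 1 := pow_le_one₀ (norm_nonneg _) hp
    linarith
  have h4 : p = ‖n‖⁻¹ • n := sub_eq_zero.1 (norm_eq_zero.1 (pow_eq_zero_iff two_ne_zero |>.1
    (h3.antisymm (sq_nonneg _))))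
  rw [← h4, hpdef, ← rho_closedBall, smul_smul, mul_inv_cancel₀ hρ.ne', one_smul]

/-- Near a boundary point where `∂U` is `C²`, the Euclidean distance to `∂U` extends from the closure
of `U` to a `C²` function, whose gradient on `∂U` is the inward unit normal. With `N = ∇F / |∇F|`, the
map `q + t e ↦ q + t N(q)`, for `q ∈ ∂U`, is a local `C¹` diffeomorphism; the coordinate `t` of its
inverse has gradient `N(q)`, which is again `C¹`. -/
theorem exists_contDiffAt_signedDistance (h : IsGraphDefining U s e F) (hU : IsOpen U)
    (hUc : IsCompact (frontier U)) (hy : y ∈ s) (hyU : y ∈ frontier U) (hF2 : ContDiffAt ℝ 2 F y) :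
    ∃ δ : E → ℝ, ContDiffAt ℝ 2 δ y ∧
      (∀ᶠ q in 𝓝 y, q ∈ frontier U → ∇ δ q = ‖∇ F q‖⁻¹ • ∇ F q) ∧
      ∀ᶠ x in 𝓝 y, x ∈ closure U → bdryDist U x = δ x := by
  have hFy := (h.mem_frontier_iff hU hy).1 hyU
  set N : E → E := fun z => ‖∇ F z‖⁻¹ • ∇ F z
  set P₀ : E → E := fun z => z - F z • e
  set Φ : E → E := fun z => z + F z • (N (P₀ z) - e)
  have hF1 := h.contDiffAt y hy
  have hP₀y : P₀ y = y := by simp [P₀, hFy]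
  have hΦy : Φ y = y := by simp [Φ, hFy]
  have hsnhds := h.isOpen.mem_nhds hy
  have hN : ContDiffAt ℝ 1 N y := by
    have hg := contDiffAt_gradient hF2
    exact ((hg.norm ℝ (h.gradient_ne_zero hy)).inv
      (norm_ne_zero_iff.2 (h.gradient_ne_zero hy))).smul hg
  have hP₀ : ContDiffAt ℝ 1 P₀ y := contDiffAt_id.sub (hF1.smul contDiffAt_const)
  have hNP₀ : ContDiffAt ℝ 1 (fun z => N (P₀ z)) y :=
    ContDiffAt.comp (g := N) y (by rwa [hP₀y]) hP₀
  have hΦ : ContDiffAt ℝ 1 Φ y :=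
    contDiffAt_id.add (hF1.smul (hNP₀.sub contDiffAt_const))
  have hnpos : 0 < ‖∇ F y‖ := norm_pos_iff.2 (h.gradient_ne_zero hy)
  obtain ⟨L, hL⟩ := exists_equiv_id_add_smulRight (InnerProductSpace.toDual ℝ E (∇ F y))
    (N y - e) (by
      rw [InnerProductSpace.toDual_apply_apply, inner_sub_right, h.inner_gradient hy,
        real_inner_smul_right, real_inner_self_eq_norm_sq, sq, inv_mul_cancel_left₀ hnpos.ne']
      simpa using h.gradient_ne_zero hy)
  have hΦ' : HasFDerivAt Φ (L : E →L[ℝ] E) y := by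
    rw [hL]
    have := (hasFDerivAt_id y).add ((h.hasFDerivAt hy).smul
      ((hNP₀.differentiableAt one_ne_zero).hasFDerivAt.sub_const e))
    simp only [hFy, hP₀y, zero_smul, zero_add] at this
    exact this
  obtain ⟨Ψ, hΨ, hΨy, hΦΨ, hΨΦ⟩ := exists_contDiffAt_localInverse hΦ hΦ' hΦy
  -- The foot point of `x`.
  set P : E → E := fun x => P₀ (Ψ x)
  have hP : ContDiffAt ℝ 1 P y := ContDiffAt.comp (g := P₀) y (by rwa [hΨy]) hΨ
  have hPy : P y = y := by simp only [P, hΨy, hP₀y]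
  have hFP : ∀ x, F (P x) = 0 := fun x => h.apply_sub_smul _
  have hNP : ContDiffAt ℝ 1 (fun x => N (P x)) y := ContDiffAt.comp (g := N) y (by rwa [hPy]) hP
  have hδ1 : ContDiffAt ℝ 1 (fun x => F (Ψ x)) y := ContDiffAt.comp (g := F) y (by rwa [hΨy]) hΨ
  have hdecomp : ∀ᶠ x in 𝓝 y, x = P x + F (Ψ x) • N (P x) := by
    filter_upwards [hΦΨ] with x hx
    conv_lhs => rw [← hx]
    simp only [Φ, P, P₀, smul_sub]
    abel
  have hPs : ∀ᶠ x in 𝓝 y, P x ∈ s := hP.continuousAt.eventually (by rwa [hPy])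
  have hgrad : ∀ᶠ x in 𝓝 y, HasGradientAt (fun x => F (Ψ x)) (N (P x)) x := by
    filter_upwards [hdecomp.eventually_nhds, hPs.eventually_nhds, hP.eventually (by simp),
      hNP.eventually (by simp), hδ1.eventually (by simp)] with x hx hxs hxP hxN hxδ
    have dP := (hxP.differentiableAt one_ne_zero).hasFDerivAt
    have dN := (hxN.differentiableAt one_ne_zero).hasFDerivAt
    have dδ := (hxδ.differentiableAt one_ne_zero).hasFDerivAt
    have hn1 : ∀ᶠ z in 𝓝 x, ‖N (P z)‖ = 1 := hxs.mono fun z hz =>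
      norm_smul_inv_norm (𝕜 := ℝ) (h.gradient_ne_zero hz)
    have hn1x := hn1.self_of_nhds
    set n := InnerProductSpace.toDual ℝ E (N (P x))
    have d1 : n ∘L fderiv ℝ P x = 0 := by
      have h1 : HasFDerivAt (fun z => F (P z)) _ x :=
        (h.hasFDerivAt hxs.self_of_nhds).comp x dP
      simp only [hFP] at h1
      have h2 := h1.unique (hasFDerivAt_const (0 : ℝ) x)
      ext w
      have h3 : ⟪∇ F (P x), fderiv ℝ P x w⟫ = 0 := DFunLike.congr_fun h2 w
      simp only [n, N, ContinuousLinearMap.comp_apply, InnerProductSpace.toDual_apply_apply,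
        real_inner_smul_left, h3, mul_zero, zero_apply]
    have d2 : n ∘L fderiv ℝ (fun z => N (P z)) x = 0 := by
      -- The product of two unit vectors is largest when they coincide.
      refine IsLocalMax.hasFDerivAt_eq_zero (f := fun z => n (N (P z))) ?_
        (n.hasFDerivAt.comp x dN)
      filter_upwards [hn1] with z hz
      simp only [n, InnerProductSpace.toDual_apply_apply]
      rw [real_inner_self_eq_norm_sq, hn1x]
      refine (real_inner_le_norm _ _).trans ?_
      rw [hn1x, hz]
      norm_num
    have d3 := n.hasFDerivAt.comp x (dP.add (dδ.smul dN))
    have d4 : HasFDerivAt (fun z => n z) n x := n.hasFDerivAt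
    have d5 := d4.unique (d3.congr_of_eventuallyEq (hx.mono fun z hz => congrArg n hz))
    have hnδ : n = fderiv ℝ (fun x => F (Ψ x)) x := by
      rw [d5]
      ext w
      have e1 : n (fderiv ℝ P x w) = 0 := DFunLike.congr_fun d1 w
      have e2 : n (fderiv ℝ (fun z => N (P z)) x w) = 0 := DFunLike.congr_fun d2 w
      have e3 : n (N (P x)) = 1 := by
        simp only [n, InnerProductSpace.toDual_apply_apply]
        rw [real_inner_self_eq_norm_sq, hn1x, one_pow]
      simp [e1, e2, e3]
    rw [hasGradientAt_iff_hasFDerivAt]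
    change HasFDerivAt _ n x
    rw [hnδ]
    exact dδ
  have hfix : ∀ᶠ q in 𝓝 y, q ∈ frontier U → Ψ q = q ∧ F q = 0 := by
    filter_upwards [hΨΦ, hsnhds] with q hq hqs hqU
    have hFq := (h.mem_frontier_iff hU hqs).1 hqU
    have : Φ q = q := by simp [Φ, hFq]
    rw [this] at hq
    exact ⟨hq, hFq⟩
  refine ⟨fun x => F (Ψ x), ?_, ?_, ?_⟩
  · have h2 : ContDiffAt ℝ ((1 : ℕ) + 1) (fun x => F (Ψ x)) y :=
      contDiffAt_succ_iff_hasFDerivAt.2 ⟨fun x => InnerProductSpace.toDual ℝ E (N (P x)),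
        ⟨_, hgrad, fun _ hx => hasGradientAt_iff_hasFDerivAt.1 hx⟩,
        (innerSL ℝ : E →L[ℝ] (E →L[ℝ] ℝ)).contDiff.contDiffAt.comp y hNP⟩
    have e2 : (((1 : ℕ) : WithTop ℕ∞) + 1) = 2 := by norm_num
    rwa [e2] at h2
  · filter_upwards [hgrad, hfix] with q hq hq' hqU
    obtain ⟨h1, h2⟩ := hq' hqU
    have : P q = q := by simp only [P, P₀, h1, h2, zero_smul, sub_zero]
    rw [hq.gradient, this]
  · -- For `x` in `U` near `y` with nearest boundary point `q`, the point `q + d(x) e` is near `y`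
    -- and is mapped to `x`.
    obtain ⟨ε, hε, hball⟩ := Metric.mem_nhds_iff.1 (inter_mem hΨΦ hsnhds)
    have hε' : 0 < ε / (3 + ‖e‖) := by positivity
    filter_upwards [hfix, Metric.ball_mem_nhds y hε'] with x hx hxy hxU
    by_cases hxU' : x ∈ U
    · obtain ⟨q, hq⟩ := exists_isRhoClosest (convex_closedBall (0 : E) 1)
        (Metric.closedBall_mem_nhds 0 one_pos) hUc ⟨y, hyU⟩ x
      have hd : dist x q = bdryDist U x := by
        have := hq.2
        rw [rho_closedBall, gauge_closedBall zero_le_one, div_one, ← dist_eq_norm] at this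
        exact this.symm
      have hle : bdryDist U x ≤ dist x y := Metric.infDist_le_dist_of_mem hyU
      have hd0 : 0 ≤ bdryDist U x := Metric.infDist_nonneg
      have hxyε : dist x y * (3 + ‖e‖) < ε := (lt_div_iff₀ (by positivity)).1 hxy
      have hen : bdryDist U x * ‖e‖ ≤ dist x y * ‖e‖ :=
        mul_le_mul_of_nonneg_right hle (norm_nonneg e)
      have hqy : dist q y ≤ 2 * dist x y := by
        have := dist_triangle_left q y x
        linarith
      have hqs : q ∈ s := (hball (Metric.mem_ball.2 (by
        nlinarith [dist_nonneg (x := x) (y := y), norm_nonneg e]))).2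
      have hzball : q + bdryDist U x • e ∈ Metric.ball y ε := by
        have h1 : dist (q + bdryDist U x • e) y ≤ bdryDist U x * ‖e‖ + dist q y := by
          refine (dist_triangle _ q y).trans (add_le_add_left ?_ _)
          rw [dist_eq_norm, add_sub_cancel_left, norm_smul, Real.norm_of_nonneg hd0]
        rw [Metric.mem_ball]
        nlinarith [dist_nonneg (x := x) (y := y), norm_nonneg e]
      have hFq := (h.mem_frontier_iff hU hqs).1 hq.1
      have hFz : F (q + bdryDist U x • e) = bdryDist U x := by rw [h.add_smul, hFq, zero_add]
      have hΦz : Φ (q + bdryDist U x • e) = x := by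
        have h1 := h.sub_eq_bdryDist_smul hU hqs hxU' hq
        have h2 : P₀ (q + bdryDist U x • e) = q := by
          simp only [P₀, hFz, add_sub_cancel_right]
        simp only [Φ, h2, hFz, smul_sub]
        rw [← h1]
        abel
      have h3 : Ψ (Φ (q + bdryDist U x • e)) = q + bdryDist U x • e := (hball hzball).1
      rw [hΦz] at h3
      rw [h3, hFz]
    · have hxf : x ∈ frontier U := ⟨hxU, by rwa [hU.interior_eq]⟩
      obtain ⟨h1, h2⟩ := hx hxf
      rw [h1, h2]
      exact Metric.infDist_zero_of_mem hxf

end IsGraphDefining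

end SignedDistance

/-! ### Regularity of the gauge distance -/

section Regularity

open Asymptotics

/-- Implicit differentiation: if a Lipschitz function `ρ` satisfies `F (x - ρ(x) p) = 0`, then
`Dρ = DF / DF(p)`. -/
theorem hasFDerivAt_of_implicit {E : Type*} [NormedAddCommGroup E] [NormedSpace ℝ E]
    {F ρ : E → ℝ} {p x : E} {l : E →L[ℝ] ℝ} {C : ℝ≥0} (hρ : LipschitzWith C ρ)
    (hF : HasFDerivAt F l (x - ρ x • p)) (hl : l p ≠ 0)
    (h0 : ∀ᶠ z in 𝓝 x, F (z - ρ z • p) = 0) :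
    HasFDerivAt ρ ((l p)⁻¹ • l) x := by
  have hρO : (fun z => ρ z - ρ x) =O[𝓝 x] fun z => z - x :=
    IsBigO.of_bound C (Eventually.of_forall fun z => hρ.norm_sub_le z x)
  have hyO : (fun z => (z - ρ z • p) - (x - ρ x • p)) =O[𝓝 x] fun z => z - x := by
    have h1 : (fun z => (ρ z - ρ x) • p) =O[𝓝 x] fun z => z - x := by
      refine (IsBigO.trans ?_ hρO)
      refine IsBigO.of_bound ‖p‖ (Eventually.of_forall fun z => ?_)
      rw [norm_smul, mul_comm]
    refine ((isBigO_refl _ _).sub h1).congr_left fun z => ?_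
    rw [sub_smul]
    abel
  have hyc : Tendsto (fun z => z - ρ z • p) (𝓝 x) (𝓝 (x - ρ x • p)) :=
    (continuous_id.sub (hρ.continuous.smul continuous_const)).tendsto x
  have h1 := ((hasFDerivAt_iff_isLittleO.1 hF).comp_tendsto hyc).trans_isBigO hyO
  have h2 : (fun z => l ((z - ρ z • p) - (x - ρ x • p))) =o[𝓝 x] fun z => z - x := by
    refine h1.neg_left.congr' ?_ EventuallyEq.rfl
    filter_upwards [h0] with z hz
    simp only [Function.comp_apply, hz, h0.self_of_nhds]
    ring
  refine hasFDerivAt_iff_isLittleO.2 ((h2.const_mul_left (-(l p)⁻¹)).congr_left fun z => ?_)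
  simp only [map_sub, map_smul, smul_eq_mul, smul_apply]
  field_simp
  ring

universe u

variable {V W : Type u} [NormedAddCommGroup V] [NormedSpace ℝ V]
  [NormedAddCommGroup W] [NormedSpace ℝ W] {α : ℝ≥0} {j k : ℕ}

theorem CkHolderAt.of_le (hα : α ≤ 1) {f : V → W} {x : V} (hf : CkHolderAt k α f x)
    (hjk : j ≤ k) : CkHolderAt j α f x := by
  induction hjk with
  | refl => exact hf
  | step _ ih => exact ih (hf.of_succ hα)

theorem CkHolderAt.sub_smul_const {E : Type} [NormedAddCommGroup E] [NormedSpace ℝ E] (hα : α ≤ 1)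
    {ρ : E → ℝ} {x : E} (h : CkHolderAt k α ρ x) (p : E) :
    CkHolderAt k α (fun z => z - ρ z • p) x := by
  have h1 : CkHolderAt k α (fun z : E => z) x := ckHolderAt_of_contDiffAt hα contDiffAt_id
  have h2 : CkHolderAt k α (fun z => -(ρ z • p)) x :=
    h.contDiffAt_comp hα (f := fun t : ℝ => -(t • p))
      (contDiff_id.smul contDiff_const).neg.contDiffAt
  simpa only [sub_eq_add_neg] using h1.add h2

/-- Bootstrapping: `ρ` solves `Dρ = M ∘ y` with `M = DF / DF(p)` of class `C^{k-1,α}` and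
`y = id - ρ p`, so each derivative known for `ρ` yields one more. -/
theorem ckHolderAt_of_implicit {E : Type} [NormedAddCommGroup E] [NormedSpace ℝ E] (hα : α ≤ 1)
    (hk : 1 ≤ k) {F ρ : E → ℝ} {p x : E} {C : ℝ≥0} (hρ : LipschitzWith C ρ)
    (hF : ∀ᶠ z in 𝓝 (x - ρ x • p), CkHolderAt k α F z) (hl : fderiv ℝ F (x - ρ x • p) p ≠ 0)
    (h0 : ∀ᶠ z in 𝓝 x, F (z - ρ z • p) = 0) : CkHolderAt k α ρ x := by
  have hFx := hF.self_of_nhds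
  set M : E → E →L[ℝ] ℝ := fun z => (fderiv ℝ F z p)⁻¹ • fderiv ℝ F z
  have hM : ∀ {j}, j + 1 ≤ k → CkHolderAt j α M (x - ρ x • p) := fun hj =>
    ((ckHolderAt_succ_iff.1 (hFx.of_le hα hj)).2).inv_smul hα
      (ContinuousLinearMap.apply ℝ ℝ p) hl
  have hyc : Continuous fun z => z - ρ z • p :=
    continuous_id.sub (hρ.continuous.smul continuous_const)
  have hcont : ContinuousAt (fderiv ℝ F) (x - ρ x • p) :=
    (hFx.1.fderiv_right (m := 0) (by exact_mod_cast hk)).continuousAt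
  have hderiv : ∀ᶠ z in 𝓝 x, HasFDerivAt ρ (M (z - ρ z • p)) z := by
    have hne : ∀ᶠ w in 𝓝 (x - ρ x • p), fderiv ℝ F w p ≠ 0 :=
      (hcont.clm_apply continuousAt_const).eventually_ne hl
    filter_upwards [(hyc.tendsto x).eventually hF, (hyc.tendsto x).eventually hne,
      h0.eventually_nhds] with z h1 h2 h3
    refine hasFDerivAt_of_implicit hρ (DifferentiableAt.hasFDerivAt ?_) h2 h3
    exact h1.1.differentiableAt (by exact_mod_cast (Nat.one_le_iff_ne_zero.1 hk))
  have hC1 : ContDiffAt ℝ ((0 : ℕ) + 1) ρ x :=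
    contDiffAt_succ_iff_hasFDerivAt.2 ⟨_, ⟨_, hderiv, fun _ h => h⟩,
      (hM (j := 0) hk).1.comp (g := M) x (contDiff_zero.2 hyc).contDiffAt⟩
  have hy1 : ContDiffAt ℝ 1 (fun z => z - ρ z • p) x :=
    contDiffAt_id.sub ((by simpa using hC1 : ContDiffAt ℝ 1 ρ x).smul contDiffAt_const)
  have main : ∀ j ≤ k, CkHolderAt j α ρ x := by
    intro j
    induction j with
    | zero => exact fun _ => ckHolderAt_of_contDiffAt hα hC1
    | succ j ih =>
      intro hj
      exact CkHolderAt.succ hderiv ((hM hj).comp hα (f := M) (g := fun z => z - ρ z • p)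
        ((ih (Nat.le_of_succ_le hj)).sub_smul_const hα p) (Or.inr hy1))
  exact main k le_rfl

end Regularity

/-! ### The derivatives of the gauge distance and of the closest point -/

section Derivatives

variable {E : Type*} [NormedAddCommGroup E] [InnerProductSpace ℝ E]
  {K U s : Set E} {e p x y : E} {F : E → ℝ}

theorem inv_inner_smul_smul {c : ℝ} (hc : c ≠ 0) (p n : E) :
    ⟪p, c • n⟫⁻¹ • c • n = ⟪p, n⟫⁻¹ • n := by
  rw [real_inner_smul_right, smul_smul, mul_inv, mul_right_comm, inv_mul_cancel₀ hc, one_mul]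

theorem smul_mem_normalCone {v : E} {c : ℝ} (hc : 0 ≤ c) (hv : v ∈ normalCone K p) :
    c • v ∈ normalCone K p := fun z hz => by
  rw [real_inner_smul_right]
  exact mul_nonpos_of_nonneg_of_nonpos hc (hv z hz)

variable [CompleteSpace E]

theorem obliqueProj_eq (h0 : K ∈ 𝓝 0) (hp : p ∈ K) {v : E}
    (hv : v ∈ interior (normalCone K p)) (hv0 : v ≠ 0) :
    obliqueProj K v = ⟪p, v⟫⁻¹ • InnerProductSpace.rankOne ℝ p v := by
  rw [obliqueProj, polarGauge_eq_inner h0 hp (interior_subset hv) hv0,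
    (hasGradientAt_polarGauge h0 hp hv hv0).gradient]

/-- The closest point of `x` lies on the line through `x` with the fixed direction
`p = (x₀ - y₀) / ρ(x₀)`: its normal is close to the one at `y₀`, hence in the interior of
`N(K, p)`, and so it is normal to `K` only at `p`. -/
theorem IsGraphDefining.eventually_isUniqueRhoClosest {x₀ y₀ : E}
    (h : IsGraphDefining U s e F) (hU : IsOpen U) (hUc : IsCompact (frontier U))
    (hK : Convex ℝ K) (hKc : IsClosed K) (hKb : Bornology.IsBounded K) (h0 : K ∈ 𝓝 0)
    (hx₀ : x₀ ∈ U) (hy₀ : IsUniqueRhoClosest K U x₀ y₀) (hy₀s : y₀ ∈ s)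
    (hp : p = (rho K U x₀)⁻¹ • (x₀ - y₀))
    (hν : inwardNormal U y₀ ∈ interior (normalCone K p)) :
    ∀ᶠ x in 𝓝 x₀, IsUniqueRhoClosest K U x (x - rho K U x • p) ∧ x - rho K U x • p ∈ s ∧
      inwardNormal U (x - rho K U x • p) ∈ interior (normalCone K p) := by
  have hpK : p ∈ K := hp ▸ hy₀.1.inv_smul_mem hK h0 hKc
  have hV : {y | y ∈ s ∧ (‖∇ F y‖⁻¹ • ∇ F y) ∈ interior (normalCone K p)} ∈ 𝓝 y₀ := by
    have hg : ContinuousAt (∇ F) y₀ :=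
      (InnerProductSpace.toDual ℝ E).symm.continuous.continuousAt.comp
        (((h.contDiffAt y₀ hy₀s).fderiv_right (m := 0) (by norm_num)).continuousAt)
    have hN : ContinuousAt (fun y => ‖∇ F y‖⁻¹ • ∇ F y) y₀ :=
      (hg.norm.inv₀ (norm_ne_zero_iff.2 (h.gradient_ne_zero hy₀s))).smul hg
    rw [h.inwardNormal_eq hU hy₀s hy₀.1.1] at hν
    exact inter_mem (h.isOpen.mem_nhds hy₀s) (hN.eventually (isOpen_interior.mem_nhds hν))
  filter_upwards [hy₀.eventually_mem hK h0 hUc hV, hU.mem_nhds hx₀] with x hx hxU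
  have key : ∀ y, IsRhoClosest K U x y → y = x - rho K U x • p ∧ y ∈ s ∧
      inwardNormal U y ∈ interior (normalCone K p) := by
    intro y hy
    obtain ⟨hys, hyν⟩ := hx y hy
    have hρ := hy.rho_pos h0 hKb hU hxU
    have h1 := smul_mem_normalCone (inv_nonneg.2 (norm_nonneg (∇ F y)))
      (h.gradient_mem_normalCone hU hys hK h0 hxU hρ hy)
    have h2 := eq_of_mem_normalCone_of_mem_interior hpK (hy.inv_smul_mem hK h0 hKc) hyν h1
    refine ⟨?_, hys, by rwa [h.inwardNormal_eq hU hys hy.1]⟩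
    rw [← h2, smul_smul, mul_inv_cancel₀ hρ.ne', one_smul, sub_sub_cancel]
  obtain ⟨y, hy⟩ := exists_isRhoClosest hK h0 hUc ⟨y₀, hy₀.1.1⟩ x
  obtain ⟨h1, h2⟩ := key y hy
  rw [← h1]
  exact ⟨⟨hy, fun z hz => by rw [(key z hz).1, h1]⟩, h2⟩

theorem IsGraphDefining.inwardNormal_ne_zero (h : IsGraphDefining U s e F) (hU : IsOpen U)
    (hy : y ∈ s) (hyU : y ∈ frontier U) : inwardNormal U y ≠ 0 := by
  rw [h.inwardNormal_eq hU hy hyU]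
  exact smul_ne_zero (inv_ne_zero (norm_ne_zero_iff.2 (h.gradient_ne_zero hy)))
    (h.gradient_ne_zero hy)

theorem IsGraphDefining.hasGradientAt_rho {C : ℝ≥0} (h : IsGraphDefining U s e F) (hU : IsOpen U)
    (h0 : K ∈ 𝓝 0) (hρ : LipschitzWith C (rho K U))
    (hx : ∀ᶠ z in 𝓝 x, z - rho K U z • p ∈ frontier U ∧ z - rho K U z • p ∈ s)
    (hν : inwardNormal U (x - rho K U x • p) ∈ interior (normalCone K p)) :
    HasGradientAt (rho K U) (⟪p, inwardNormal U (x - rho K U x • p)⟫⁻¹ •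
      inwardNormal U (x - rho K U x • p)) x := by
  obtain ⟨hyU, hys⟩ := hx.self_of_nhds
  have hν0 := h.inwardNormal_ne_zero hU hys hyU
  have hpos := inner_pos_of_mem_normalCone h0 (interior_subset hν) hν0
  have hc : ‖∇ F (x - rho K U x • p)‖⁻¹ ≠ 0 :=
    inv_ne_zero (norm_ne_zero_iff.2 (h.gradient_ne_zero hys))
  rw [h.inwardNormal_eq hU hys hyU] at hpos ⊢
  rw [inv_inner_smul_smul hc, hasGradientAt_iff_hasFDerivAt, map_smul, real_inner_comm]
  refine hasFDerivAt_of_implicit hρ (h.hasFDerivAt hys) ?_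
    (hx.mono fun z hz => (h.mem_frontier_iff hU hz.2).1 hz.1)
  rw [InnerProductSpace.toDual_apply_apply, real_inner_comm]
  rw [real_inner_smul_right] at hpos
  exact right_ne_zero_of_mul hpos.ne'

/-- On the closure of `U`, the second derivative of the Euclidean distance is that of any `C²`
extension. -/
theorem IsGraphDefining.hessianWithin_bdryDist_eq {δ : E → ℝ} (h : IsGraphDefining U s e F)
    (hU : IsOpen U) (hy : y ∈ s) (hyU : y ∈ closure U) (hδ : ContDiffAt ℝ 2 δ y)
    (hd : ∀ᶠ z in 𝓝 y, z ∈ closure U → bdryDist U z = δ z) :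
    hessianWithin (bdryDist U) (closure U) y = fderiv ℝ (∇ δ) y := by
  have hgrad : ∀ᶠ z in 𝓝 y, z ∈ closure U → gradientWithin (bdryDist U) (closure U) z = ∇ δ z := by
    filter_upwards [hd.eventually_nhds, h.isOpen.mem_nhds hy, hδ.eventually (by simp)]
      with z hz hzs hzδ hzU
    have hu := h.uniqueDiffWithinAt_closure hU hzs hzU
    have he : bdryDist U =ᶠ[𝓝[closure U] z] δ := eventually_nhdsWithin_iff.2 hz
    rw [gradientWithin, gradient, he.fderivWithin_eq (hz.self_of_nhds hzU),
      fderivWithin_eq_fderiv hu (hzδ.differentiableAt two_ne_zero)]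
  have he : (fun z => gradientWithin (bdryDist U) (closure U) z) =ᶠ[𝓝[closure U] y] ∇ δ :=
    eventually_nhdsWithin_iff.2 hgrad
  rw [hessianWithin, he.fderivWithin_eq (hgrad.self_of_nhds hyU),
    fderivWithin_eq_fderiv (h.uniqueDiffWithinAt_closure hU hy hyU)
      ((contDiffAt_gradient hδ).differentiableAt one_ne_zero)]

/-- Derivative of `⟪p, G⟫⁻¹ G` for a vector field `G`. -/
theorem hasFDerivAt_inv_inner_smul {G : E → E} {G' : E →L[ℝ] E} (hG : HasFDerivAt G G' x)
    (hp : ⟪p, G x⟫ ≠ 0) :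
    HasFDerivAt (fun z => ⟪p, G z⟫⁻¹ • G z)
      (⟪p, G x⟫⁻¹ • ((ContinuousLinearMap.id ℝ E - ContinuousLinearMap.adjoint
        (⟪p, G x⟫⁻¹ • InnerProductSpace.rankOne ℝ p (G x))) ∘L G')) x := by
  have h1 : HasFDerivAt (fun z => ⟪p, G z⟫) (InnerProductSpace.toDual ℝ E p ∘L G') x :=
    (InnerProductSpace.toDual ℝ E p).hasFDerivAt.comp x hG
  have h2 := ((hasDerivAt_inv hp).comp_hasFDerivAt x h1).smul hG
  refine h2.congr_fderiv ?_
  ext1 w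
  simp only [map_smulₛₗ, InnerProductSpace.adjoint_rankOne]
  simp [smul_smul, sq, sub_eq_add_neg]

/-- The second derivative of `ρ` comes from differentiating `∇ρ = ν / γ°(ν)`, where `ν = ∇δ ∘ y` for
a `C²` extension `δ` of the Euclidean distance and `γ° = ⟪p, ·⟫` near `ν`. -/
theorem IsGraphDefining.hasFDerivAt_gradient_rho {Y : E → E} {Y' : E →L[ℝ] E}
    (h : IsGraphDefining U s e F) (hU : IsOpen U) (hUc : IsCompact (frontier U))
    (hF : ContDiffAt ℝ 2 F (Y x)) (hY : HasFDerivAt Y Y' x)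
    (hYs : ∀ᶠ z in 𝓝 x, Y z ∈ frontier U ∧ Y z ∈ s)
    (hρ : ∀ᶠ z in 𝓝 x, HasGradientAt (rho K U)
      (⟪p, inwardNormal U (Y z)⟫⁻¹ • inwardNormal U (Y z)) z)
    (hp : ⟪p, inwardNormal U (Y x)⟫ ≠ 0) :
    ContDiffWithinAt ℝ 2 (bdryDist U) (closure U) (Y x) ∧
      HasFDerivAt (fun z => ∇ (rho K U) z)
        (⟪p, inwardNormal U (Y x)⟫⁻¹ • ((ContinuousLinearMap.id ℝ E -
          ContinuousLinearMap.adjoint (⟪p, inwardNormal U (Y x)⟫⁻¹ •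
            InnerProductSpace.rankOne ℝ p (inwardNormal U (Y x)))) ∘L
          hessianWithin (bdryDist U) (closure U) (Y x) ∘L Y')) x := by
  obtain ⟨hyU, hys⟩ := hYs.self_of_nhds
  have hyc : Y x ∈ closure U := frontier_subset_closure hyU
  obtain ⟨δ, hδ, hδN, hδd⟩ := h.exists_contDiffAt_signedDistance hU hUc hys hyU hF
  have hG : ∀ᶠ z in 𝓝 x, inwardNormal U (Y z) = ∇ δ (Y z) := by
    filter_upwards [hYs, hY.continuousAt.eventually hδN] with z hz hz'
    rw [h.inwardNormal_eq hU hz.2 hz.1, hz' hz.1]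
  refine ⟨hδ.contDiffWithinAt.congr_of_eventuallyEq (eventually_nhdsWithin_iff.2 hδd)
    (hδd.self_of_nhds hyc), ?_⟩
  rw [h.hessianWithin_bdryDist_eq hU hys hyc hδ hδd]
  have hd : HasFDerivAt (fun z => ∇ δ (Y z)) (fderiv ℝ (∇ δ) (Y x) ∘L Y') x :=
    ((contDiffAt_gradient hδ).differentiableAt one_ne_zero).hasFDerivAt.comp x hY
  rw [hG.self_of_nhds] at hp ⊢
  refine (hasFDerivAt_inv_inner_smul hd hp).congr_of_eventuallyEq ?_
  filter_upwards [hρ, hG] with z hz hz'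
  rw [hz.gradient, hz']

end Derivatives

end GaugeDist

theorem mainTheorem1 (n : ℕ)
    (K : Set (EuclideanSpace ℝ (Fin n))) (hKcompact : IsCompact K) (hKconvex : Convex ℝ K)
    (hK0 : 0 ∈ interior K)
    (U : Set (EuclideanSpace ℝ (Fin n))) (hUopen : IsOpen U) (hUbdd : Bornology.IsBounded U)
    (k : ℕ) (hk : 1 ≤ k) (α : ℝ≥0) (hα : α ≤ 1)
    (hU : GaugeDist.HasCkHolderBoundary k α U)
    (x₀ y₀ : EuclideanSpace ℝ (Fin n)) (hx₀ : x₀ ∈ U)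
    (hy₀ : GaugeDist.IsUniqueRhoClosest K U x₀ y₀)
    (hν₀ : GaugeDist.inwardNormal U y₀ ∈
      interior (GaugeDist.normalCone K ((GaugeDist.rho K U x₀)⁻¹ • (x₀ - y₀)))) :
    ∃ r : ℝ, 0 < r ∧ Metric.ball x₀ r ⊆ U ∧
      GaugeDist.IsCkHolderOn k α (GaugeDist.rho K U) (Metric.ball x₀ r) ∧
      ∃ y : EuclideanSpace ℝ (Fin n) → EuclideanSpace ℝ (Fin n),
        GaugeDist.IsCkHolderOn k α y (Metric.ball x₀ r) ∧
        Tendsto y (𝓝 x₀) (𝓝 y₀) ∧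
        ∀ x ∈ Metric.ball x₀ r,
          GaugeDist.IsUniqueRhoClosest K U x (y x) ∧
          HasGradientAt (GaugeDist.rho K U)
            ((GaugeDist.polarGauge K (GaugeDist.inwardNormal U (y x)))⁻¹ •
              GaugeDist.inwardNormal U (y x)) x ∧
          DifferentiableAt ℝ (GaugeDist.polarGauge K) (GaugeDist.inwardNormal U (y x)) ∧
          HasFDerivAt y
            (ContinuousLinearMap.id ℝ (EuclideanSpace ℝ (Fin n)) -
              GaugeDist.obliqueProj K (GaugeDist.inwardNormal U (y x))) x ∧
          (2 ≤ k →
            ContDiffWithinAt ℝ 2 (GaugeDist.bdryDist U) (closure U) (y x) ∧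
            HasFDerivAt (fun z => ∇ (GaugeDist.rho K U) z)
              ((GaugeDist.polarGauge K (GaugeDist.inwardNormal U (y x)))⁻¹ •
                ((ContinuousLinearMap.id ℝ (EuclideanSpace ℝ (Fin n)) -
                    ContinuousLinearMap.adjoint
                      (GaugeDist.obliqueProj K (GaugeDist.inwardNormal U (y x)))) ∘L
                  GaugeDist.hessianWithin (GaugeDist.bdryDist U) (closure U) (y x) ∘L
                  (ContinuousLinearMap.id ℝ (EuclideanSpace ℝ (Fin n)) -
                    GaugeDist.obliqueProj K (GaugeDist.inwardNormal U (y x))))) x) := by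
  have hK0' : K ∈ 𝓝 0 := mem_interior_iff_mem_nhds.1 hK0
  have hKc := hKcompact.isClosed
  have hUc : IsCompact (frontier U) :=
    Metric.isCompact_of_isClosed_isBounded isClosed_frontier
      (hUbdd.closure.subset frontier_subset_closure)
  set p := (GaugeDist.rho K U x₀)⁻¹ • (x₀ - y₀) with hp
  have hpK : p ∈ K := hy₀.1.inv_smul_mem hKconvex hK0' hKc
  obtain ⟨e, s, F, hy₀s, h, hF⟩ := hU.exists_isGraphDefining hk hα hy₀.1.1
  obtain ⟨C, hC⟩ := GaugeDist.exists_lipschitzWith_rho hKconvex hK0' hUc ⟨y₀, hy₀.1.1⟩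
  -- For `x` near `x₀` the closest point to `x` is `Y x`.
  set Y : EuclideanSpace ℝ (Fin n) → EuclideanSpace ℝ (Fin n) :=
    fun x => x - GaugeDist.rho K U x • p
  have hYc : Continuous Y := continuous_id.sub (hC.continuous.smul continuous_const)
  let Q : EuclideanSpace ℝ (Fin n) → Prop := fun z => GaugeDist.IsUniqueRhoClosest K U z (Y z) ∧
    Y z ∈ s ∧ GaugeDist.inwardNormal U (Y z) ∈ interior (GaugeDist.normalCone K p)
  have hev : ∀ᶠ z in 𝓝 x₀, Q z := h.eventually_isUniqueRhoClosest hUopen hUc hKconvex hKc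
    hKcompact.isBounded hK0' hx₀ hy₀ hy₀s hp hν₀
  have hYx₀ : Y x₀ = y₀ := hy₀.2 _ hev.self_of_nhds.1.1
  have hYs : ∀ {x}, (∀ᶠ z in 𝓝 x, Q z) →
      ∀ᶠ z in 𝓝 x, Y z ∈ frontier U ∧ Y z ∈ s := fun hx => hx.mono fun z hz => ⟨hz.1.1.1, hz.2.1⟩
  have hν0 : ∀ {x}, GaugeDist.IsUniqueRhoClosest K U x (Y x) → Y x ∈ s →
      GaugeDist.inwardNormal U (Y x) ≠ 0 := fun hx hs => h.inwardNormal_ne_zero hUopen hs hx.1.1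
  have hgrad : ∀ {x}, (∀ᶠ z in 𝓝 x, Q z) →
      HasGradientAt (GaugeDist.rho K U) (⟪p, GaugeDist.inwardNormal U (Y x)⟫⁻¹ •
        GaugeDist.inwardNormal U (Y x)) x := fun hx =>
    h.hasGradientAt_rho hUopen hK0' hC (hYs hx) hx.self_of_nhds.2.2
  have hρk : GaugeDist.CkHolderAt k α (GaugeDist.rho K U) x₀ := by
    obtain ⟨h1, h2, h3⟩ := hev.self_of_nhds
    refine GaugeDist.ckHolderAt_of_implicit hα hk hC
      ((h.isOpen.eventually_mem h2).mono fun z hz => hF z hz) ?_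
      ((hYs hev).mono fun z hz => (h.mem_frontier_iff hUopen hz.2).1 hz.1)
    have hpos := GaugeDist.inner_pos_of_mem_normalCone hK0' (interior_subset h3) (hν0 h1 h2)
    rw [h.inwardNormal_eq hUopen h2 h1.1.1, real_inner_smul_right, real_inner_comm] at hpos
    rw [(h.hasFDerivAt h2).fderiv]
    exact right_ne_zero_of_mul hpos.ne'
  have hYk : GaugeDist.CkHolderAt k α Y x₀ := hρk.sub_smul_const hα p
  obtain ⟨ε, hε, hball⟩ := Metric.mem_nhds_iff.1
    (inter_mem hev.eventually_nhds (hUopen.mem_nhds hx₀))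
  obtain ⟨r, ⟨hr1, hr2⟩, hr⟩ := ((hρk.eventually_isCkHolderOn.and hYk.eventually_isCkHolderOn).and
    (Ioo_mem_nhdsGT hε)).exists
  have hsub := (Metric.ball_subset_ball (x := x₀) hr.2.le).trans hball
  refine ⟨r, hr.1, fun x hx => (hsub hx).2, hr1, Y, hr2, ?_, fun x hx => ?_⟩
  · rw [← hYx₀]
    exact hYc.tendsto x₀
  have hxev : ∀ᶠ z in 𝓝 x, Q z := (hsub hx).1
  obtain ⟨hxY, hxs, hxν⟩ := hxev.self_of_nhds
  have hxν0 := hν0 hxY hxs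
  have hpos := GaugeDist.inner_pos_of_mem_normalCone hK0' (interior_subset hxν) hxν0
  have hYd : HasFDerivAt Y (ContinuousLinearMap.id ℝ (EuclideanSpace ℝ (Fin n)) -
      ⟪p, GaugeDist.inwardNormal U (Y x)⟫⁻¹ •
        InnerProductSpace.rankOne ℝ p (GaugeDist.inwardNormal U (Y x))) x := by
    refine ((hasFDerivAt_id x).sub
      ((hasGradientAt_iff_hasFDerivAt.1 (hgrad hxev)).smul_const p)).congr_fderiv ?_
    ext1 w
    simp [smul_smul]
  rw [GaugeDist.obliqueProj_eq hK0' hpK hxν hxν0,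
    GaugeDist.polarGauge_eq_inner hK0' hpK (interior_subset hxν) hxν0]
  refine ⟨hxY, hgrad hxev,
    (GaugeDist.hasGradientAt_polarGauge hK0' hpK hxν hxν0).differentiableAt, hYd, fun hk2 => ?_⟩
  exact h.hasFDerivAt_gradient_rho hUopen hUc ((hF _ hxs).1.of_le (by exact_mod_cast hk2)) hYd
    (hYs hxev) (hxev.eventually_nhds.mono fun z hz => hgrad hz) hpos.ne'
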